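/- **Setting.** Let $X$ and $Y$ have state space $\{1,\dots,n\}$, let $p^Y$ be a probability distribution on $\{1,\dots,n\}$, let $\beta,\tau>0$, and for each $y$ let $\mathcal N_y$ be a symmetric set of pairs of distinct states of $X$ (the allowed transitions). A *feedback process* consists of nonnegative rates $R_t^{y}(x,x')$ for $0<t<\tau$ (from $(x',y)$ to $(x,y)$), which vanish for $(x',x)\notin\mathcal N_y$ and satisfy $R_t^{y}(x,x')>0\iff R_t^{y}(x',x)>0$, and an absolutely continuous nonnegative solution $p_t(x,y)$, $t\in[0,\tau]$, of the master equation $\dot p_t(x,y)=\sum_{x'}[R_t^{y}(x,x')p_t(x',y)-R_t^{y}(x',x)p_t(x,y)]$ (for almost every $t$) with $p_0(x,y)=\delta_{x,y}\,p^Y(y)$. Put $j_t^y(x,x')=R_t^y(x,x')p_t(x',y)$ and $J_t^y(x,x')=j_t^y(x,x')-j_t^y(x',x)$; the functions $j_t^y(x,x')$ and $j_t^y(x,x')\ln\frac{R_t^y(x,x')}{R_t^y(x',x)}$ (read as $0$ where the rates vanish) are assumed integrable on $[0,\tau]$. With $S$ the Shannon entropy and $p^X_t,p^Y_t$ the marginals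 of $p_t$, let $$\beta Q_\tau=-\int_0^\tau\sum_{x,x',y}j_t^y(x,x')\ln\frac{R_t^y(x,x')}{R_t^y(x',x)}\,dt,\qquad \Sigma_\tau^X=S(p_\tau^X)-S(p_0^X)-\beta Q_\tau,$$ $$I_t=S(p_t^X)+S(p_t^Y)-S(p_t),\quad \Delta I=I_\tau-I_0,\quad a_t=\sum_{y,\,x\ne x'}j_t^y(x,x'),\quad \langle a\rangle_\tau=\frac1\tau\int_0^\tau a_t\,dt .$$ Let $p_\downarrow$ be $p^Y$ rearranged in descending order. For $\mathcal E\in[0,1]$ let $\tilde p_{\mathcal E}=p_\downarrow$ if $p_\downarrow(1)\ge 1-\mathcal E$; otherwise let $M_{\mathcal E}$ be the largest $m\in\{2,\dots,n\}$ with $\frac{\mathcal E-\sum_{k>m}p_\downarrow(k)}{m-1}<p_\downarrow(m)$, and let $\tilde p_{\mathcal E}(1)=1-\mathcal E$, $\tilde p_{\mathcal E}(k)=\frac{\mathcal E-\sum_{l>M_{\mathcal E}}p_\downarrow(l)}{M_{\mathcal E}-1}$ for $2\le k\le M_{\mathcal E}$, and $\tilde p_{\mathcal E}(k)=p_\downarrow(k)$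 for $k>M_{\mathcal E}$. For $p,q$ with the same $Y$-marginal, a transport plan is a family $\pi_y(x,x')\ge0$ with $\sum_x\pi_y(x,x')=p(x',y)$ and $\sum_{x'}\pi_y(x,x')=q(x,y)$; $\mathcal W(p,q)$ is the minimum over plans of $\sum_{y,x,x'}d_y(x',x)\,\pi_y(x,x')$, where $d_y(x',x)\in\{0,1,\dots,\infty\}$ is the least number of transitions in $\mathcal N_y$ leading from $x'$ to $x$. Minimizing plans are called optimal. **Statement.** 1. The map $W\mapsto S(\tilde p_W)$ is a bijection from $[0,1-p_\downarrow(1)]$ onto $[0,S(p^Y)]$. Let $\mathcal W^{\min}_{p^Y}$ be its inverse. 2. For every feedback process, with $\mathcal W^{\min}=\mathcal W^{\min}_{p^Y}(|\Delta I|)$, one has $|\Delta I|\le S(p^Y)$, $0\le \mathcal W^{\min}/(\tau\langle a\rangle_\tau)<1$ (with $0/0=0$), and $$\Sigma_\tau^X\ \ge\ -|\Delta I|+2\,\mathcal W^{\min}\tanh^{-1}\!\frac{\mathcal W^{\min}}{\tau\langle a\rangle_\tau}.$$ 3. Assume (C): for every $y$ and every $x\neq y$ the direct transition from $(y,y)$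 to $(x,y)$ is allowed. Let $\sigma$ be any permutation ranking the states in descending order of $p^Y$ (so $\sigma(y)=k$ means that $p^Y(y)$ is the $k$-th largest value), let $I\in[0,S(p^Y)]$ and $W=\mathcal W^{\min}_{p^Y}(I)$. Let $p^*(x,y)=p^{*X}(x)\,p^{*}(y|x)$, where, if $W<1-p_\downarrow(1)$, $p^{*X}(x)=\frac{p^Y(x)-\tilde p_W(2)}{\tilde p_W(1)-\tilde p_W(2)}$ for $\sigma(x)\le M_W$ and $p^{*X}(x)=0$ otherwise, while if $W=1-p_\downarrow(1)$, $p^{*X}$ is the point mass at $\sigma^{-1}(1)$; and $p^*(y|x)=\tilde p_W(1)$ if $y=x$, $\tilde p_W(\sigma(x))$ if $y\ne x$ and $\sigma(y)=1$, and $\tilde p_W(\sigma(y))$ otherwise. Then: - $p^*$ is a probability distribution with $Y$-marginal $p^Y$, $\mathcal W(p_0,p^*)=W$, and a process that ends in $p^*$ has $|\Delta I|=I$. - Call a feedback process *constant along a plan* $\pi$, with current $J$ and activity $A$, if the net probability carried by each transition is $\int_0^\tau J_t^y(x,x')\,dt=\pi_y(x,x')-\pi_y(x',x)$ for $x\ne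 x'$, and for all $0<t<\tau$: $j_t^y(x,x')=0$ whenever $x\neq x'$ and $\pi_y(x,x')=\pi_y(x',x)=0$; the total current $\sum J_t^y(x,x')$ over all $(y,x,x')$ with $x\ne x'$ and $\pi_y(x,x')>0$ equals $J$; $a_t=A$; and the force $\ln\frac{j_t^y(x,x')}{j_t^y(x',x)}$ has one and the same value for all $t$ and all $(y,x,x')$ with $x\ne x'$, $\pi_y(x,x')>0$ and $j_t^y(x,x')+j_t^y(x',x)>0$. Every feedback process that ends in $p_\tau=p^*$ and is constant (for some $J,A$) along an optimal plan from $p_0$ to $p^*$ attains equality in 2. - If $I>0$ and $\tau A>W$, or if $I=0$ and $A=0$, there is a feedback process with $p_\tau=p^*$ that is constant along an optimal plan from $p_0$ to $p^*$ with current $J=W/\tau$ and activity $A$; it has $\langle a\rangle_\tau=A$ and $|\Delta I|=I$ and attains equality in 2. -/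

import Mathlib

open MeasureTheory Set

namespace Feedback

noncomputable section

/-! States of `X` and of `Y` are labelled by `Fin n`.  A joint distribution is a function
`p : Fin n → Fin n → ℝ`, with `p x y` the probability of `(x, y)`. -/

/-- Shannon entropy (natural logarithm, `0 ln 0 = 0`). -/
def shannon {ι : Type*} [Fintype ι] (p : ι → ℝ) : ℝ := ∑ i, Real.negMulLog (p i)

def marginalX {n : ℕ} (p : Fin n → Fin n → ℝ) (x : Fin n) : ℝ := ∑ y, p x y

def marginalY {n : ℕ} (p : Fin n → Fin n → ℝ) (y : Fin n) : ℝ := ∑ x, p x y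

def mutualInfo {n : ℕ} (p : Fin n → Fin n → ℝ) : ℝ :=
  shannon (marginalX p) + shannon (marginalY p) - shannon (fun z : Fin n × Fin n => p z.1 z.2)

/-- The error-free initial distribution `δ_{x,y} p^Y(y)`. -/
def initialDist {n : ℕ} (pY : Fin n → ℝ) (x y : Fin n) : ℝ := if x = y then pY y else 0

/-- A feedback process on the time interval `[0, τ]`.  The graph `N y` is the set of allowed
(bidirectional) transitions of `X` when the measurement result is `y`; the state of `Y` never
changes.  `rate t y x u` is the transition rate at time `t` from `(u, y)` to `(x, y)`, and
`prob t x y` the probability of `(x, y)` at time `t`.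

The master equation is required in integrated form, i.e. `prob` is absolutely continuous and
satisfies the differential equation at almost every time, so that protocols which are switched at
some instants, or whose rates are unbounded near the end points, are allowed.  The mean number
of jumps and the mean heat are required to be well defined (integrable). -/
structure FeedbackProcess {n : ℕ} (N : Fin n → SimpleGraph (Fin n)) (pY : Fin n → ℝ)
    (τ : ℝ) where
  rate : ℝ → Fin n → Fin n → Fin n → ℝ
  prob : ℝ → Fin n → Fin n → ℝ
  rate_nonneg : ∀ t ∈ Ioo 0 τ, ∀ y x u, 0 ≤ rate t y x u
  /-- Only allowed transitions occur. -/
  rate_eq_zero : ∀ t ∈ Ioo 0 τ, ∀ y x u, ¬ (N y).Adj u x → rate t y x u = 0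
  /-- The two rates of a transition vanish simultaneously, so that local detailed balance can hold. -/
  rate_pos_symm : ∀ t ∈ Ioo 0 τ, ∀ y x u, 0 < rate t y x u → 0 < rate t y u x
  prob_nonneg : ∀ t ∈ Icc 0 τ, ∀ x y, 0 ≤ prob t x y
  prob_zero : prob 0 = initialDist pY
  jump_integrable : ∀ y x u,
    IntervalIntegrable (fun t => rate t y x u * prob t u y) volume 0 τ
  /-- The master equation; since rates off `N y` vanish, the sum may run over all `u`. -/
  master : ∀ t ∈ Icc 0 τ, ∀ x y, prob t x y = prob 0 x y +
    ∫ s in (0 : ℝ)..t, ∑ u, (rate s y x u * prob s u y - rate s y u x * prob s x y)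
  heat_integrable : ∀ y x u, IntervalIntegrable
    (fun t => Real.log (rate t y x u / rate t y u x) * (rate t y x u * prob t u y)) volume 0 τ

namespace FeedbackProcess

variable {n : ℕ} {N : Fin n → SimpleGraph (Fin n)} {pY : Fin n → ℝ} {τ : ℝ}

/-- Probability of a transition `(u, y) → (x, y)` per unit time. -/
def jump (P : FeedbackProcess N pY τ) (t : ℝ) (y x u : Fin n) : ℝ :=
  P.rate t y x u * P.prob t u y

/-- Probability current from `(u, y)` to `(x, y)`. -/
def current (P : FeedbackProcess N pY τ) (t : ℝ) (y x u : Fin n) : ℝ :=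
  P.jump t y x u - P.jump t y u x

/-- Thermodynamic force of the transition `(u, y) → (x, y)`. -/
def force (P : FeedbackProcess N pY τ) (t : ℝ) (y x u : Fin n) : ℝ :=
  Real.log (P.jump t y x u / P.jump t y u x)

/-- Stochastic heat absorbed in a transition `(u, y) → (x, y)`, given by local detailed balance
`ln (R(x,u) / R(u,x)) = -β Q(x,u)`. -/
def stochasticHeat (P : FeedbackProcess N pY τ) (β t : ℝ) (y x u : Fin n) : ℝ :=
  -(1 / β) * Real.log (P.rate t y x u / P.rate t y u x)

/-- Mean heat absorbed by `X` during `[0, τ]`. -/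
def heat (P : FeedbackProcess N pY τ) (β : ℝ) : ℝ :=
  ∫ t in (0 : ℝ)..τ, ∑ y, ∑ x, ∑ u, P.stochasticHeat β t y x u * P.jump t y x u

/-- Entropy production `Σ_τ^X` of the subsystem `X`. -/
def entropyProduction (P : FeedbackProcess N pY τ) (β : ℝ) : ℝ :=
  shannon (marginalX (P.prob τ)) - shannon (marginalX (P.prob 0)) - β * P.heat β

/-- Change `ΔI` of the mutual information. -/
def infoChange (P : FeedbackProcess N pY τ) : ℝ :=
  mutualInfo (P.prob τ) - mutualInfo (P.prob 0)

/-- Activity `a_t`: expected number of jumps per unit time. -/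
def activity (P : FeedbackProcess N pY τ) (t : ℝ) : ℝ :=
  ∑ y, ∑ x, ∑ u, if x ≠ u then P.jump t y x u else 0

/-- Time-averaged activity `⟨a⟩_τ`. -/
def meanActivity (P : FeedbackProcess N pY τ) : ℝ :=
  (∫ t in (0 : ℝ)..τ, P.activity t) / τ

end FeedbackProcess

/-- `π y x u` is the probability transported from `(u, y)` to `(x, y)`. -/
structure IsTransportPlan {n : ℕ} (p q : Fin n → Fin n → ℝ) (π : Fin n → Fin n → Fin n → ℝ) :
    Prop where
  nonneg : ∀ y x u, 0 ≤ π y x u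
  source : ∀ y u, ∑ x, π y x u = p u y
  target : ∀ y x, ∑ u, π y x u = q x y

/-- Transport cost; the cost per unit probability is the minimal number of allowed transitions
(`⊤` if there is no path). -/
def transportCost {n : ℕ} (N : Fin n → SimpleGraph (Fin n)) (π : Fin n → Fin n → Fin n → ℝ) :
    ENNReal :=
  ∑ y, ∑ x, ∑ u, ((N y).edist u x : ENNReal) * ENNReal.ofReal (π y x u)

/-- The Wasserstein distance between joint distributions with the same `Y`-marginal. -/
def wasserstein {n : ℕ} (N : Fin n → SimpleGraph (Fin n)) (p q : Fin n → Fin n → ℝ) : ENNReal :=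
  ⨅ π ∈ {π | IsTransportPlan p q π}, transportCost N π

structure IsOptimalPlan {n : ℕ} (N : Fin n → SimpleGraph (Fin n)) (p q : Fin n → Fin n → ℝ)
    (π : Fin n → Fin n → Fin n → ℝ) : Prop where
  isPlan : IsTransportPlan p q π
  optimal : transportCost N π = wasserstein N p q

/-- The process carries the probability along the plan `π`, by direct transitions, at constant
total current `J` and constant activity `A`, with a force that is constant in time and the same
for all transitions in use. -/
structure IsConstantProtocol {n : ℕ} {N : Fin n → SimpleGraph (Fin n)} {pY : Fin n → ℝ} {τ : ℝ}
    (P : FeedbackProcess N pY τ) (π : Fin n → Fin n → Fin n → ℝ) (J A : ℝ) : Prop where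
  /-- The net probability carried by each transition is the one prescribed by the plan. -/
  transport : ∀ y x u, x ≠ u → ∫ t in (0 : ℝ)..τ, P.current t y x u = π y x u - π y u x
  /-- There is no traffic between states that the plan does not connect. -/
  off_plan : ∀ t ∈ Ioo 0 τ, ∀ y x u, x ≠ u → π y x u = 0 → π y u x = 0 → P.jump t y x u = 0
  /-- Total current along the plan. -/
  current_const : ∀ t ∈ Ioo 0 τ,
    (∑ y, ∑ x, ∑ u, if x ≠ u ∧ 0 < π y x u then P.current t y x u else 0) = J
  activity_const : ∀ t ∈ Ioo 0 τ, P.activity t = A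
  force_const : ∃ F : ℝ, ∀ t ∈ Ioo 0 τ, ∀ y x u, x ≠ u → 0 < π y x u →
    0 < P.jump t y x u + P.jump t y u x → P.force t y x u = F

/-! The distribution `p̃_E` of the achievable Fano inequality.  Ranks are elements of `Fin n`, so the
rank called `m` in `1, …, n` is the element of `Fin n` with value `m - 1`. -/

/-- `p` rearranged in descending order. -/
def sortDesc {n : ℕ} (p : Fin n → ℝ) (k : Fin n) : ℝ := p (Tuple.sort (fun i => -p i) k)

/-- The largest `m ∈ {2, …, n}` with `(E - ∑_{j > m} p↓(j)) / (m - 1) < p↓(m)`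
(only used when `p↓(1) < 1 - E`, and then it exists). -/
def cutoff {n : ℕ} (p : Fin n → ℝ) (E : ℝ) : ℕ :=
  (Finset.univ.filter (fun k : Fin n => 0 < k.val ∧
    (E - ∑ j, if k < j then sortDesc p j else 0) / (k.val : ℝ) < sortDesc p k)).sup
    (fun k => k.val + 1)

/-- `p̃_E`. -/
def fanoDist {n : ℕ} [NeZero n] (p : Fin n → ℝ) (E : ℝ) (k : Fin n) : ℝ :=
  if 1 - E ≤ sortDesc p 0 then sortDesc p k
  else if k = 0 then 1 - E
  else if k.val + 1 ≤ cutoff p E then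
    (E - ∑ j : Fin n, if cutoff p E < j.val + 1 then sortDesc p j else 0) / ((cutoff p E : ℝ) - 1)
  else sortDesc p k

/-- `W^min_p`, the inverse of `W ↦ S(p̃_W)` on `[0, 1 - p↓(1)]`. -/
def minWasserstein {n : ℕ} [NeZero n] (p : Fin n → ℝ) : ℝ → ℝ :=
  Function.invFunOn (fun W => shannon (fanoDist p W)) (Icc 0 (1 - sortDesc p 0))

/-- The `X`-marginal of the optimal final distribution; `σ y` is the rank of `y` in a descending
ordering of `p`.  At the end point `W = 1 - p↓(1)` it is the point mass at the first state. -/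
def optimalX {n : ℕ} [NeZero n] (p : Fin n → ℝ) (σ : Equiv.Perm (Fin n)) (W : ℝ) (x : Fin n) : ℝ :=
  if 1 - W ≤ sortDesc p 0 then (if σ x = 0 then 1 else 0)
  else if (σ x).val + 1 ≤ cutoff p W then
    (p x - fanoDist p W 1) / (fanoDist p W 0 - fanoDist p W 1)
  else 0

/-- The conditional distribution of `Y` given `x` of the optimal final distribution: `p̃_W`
rearranged in the order of `p`, with the values at `x` and at the first state swapped. -/
def optimalCond {n : ℕ} [NeZero n] (p : Fin n → ℝ) (σ : Equiv.Perm (Fin n)) (W : ℝ)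
    (x y : Fin n) : ℝ :=
  if y = x then fanoDist p W 0
  else if σ y = 0 then fanoDist p W (σ x)
  else fanoDist p W (σ y)

/-- The optimal final distribution. -/
def optimalFinal {n : ℕ} [NeZero n] (p : Fin n → ℝ) (σ : Equiv.Perm (Fin n)) (W : ℝ)
    (x y : Fin n) : ℝ :=
  optimalX p σ W x * optimalCond p σ W x y

/-- The right-hand side `-I + 2 W artanh (W / (τ a))`, `W = W^min_p(I)`, of the speed limit. -/
def activityBound {n : ℕ} [NeZero n] (p : Fin n → ℝ) (τ a I : ℝ) : ℝ :=
  -I + 2 * minWasserstein p I * Real.artanh (minWasserstein p I / (τ * a))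

end

end Feedback

/-!
The process starts without errors, so `|ΔI|` is the final conditional entropy of `Y` given `X`.
Fano's inequality in its sharp form says that a conditional entropy `I` forces an error probability
of at least `minWasserstein pY I`: a permutation of each row collects the error-free probability in
one column while the other column sums stay below the sorted `pY`, and under these constraints the
water-filling `fanoDist` has the largest entropy.
All this probability has to flow out of the error-free states `(y, y)`.

The dissipation `(a - b) * log (a / b)` of a transition is a convex and homogeneous function of its
two jump frequencies, so it lies above its tangent at the jumps with any prescribed force `F`.
Summed over the transitions and integrated over time, the tangent depends only on the total outflow
and on the total activity, and the best choice of `F` produces the inverse hyperbolic tangent.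
The tangent at `F` is exact where the force is `F`; hence a constant force along the transport from
the error-free distribution to the Fano-optimal one gives equality.
-/

namespace Feedback

noncomputable section

open Filter Topology

/-! ### Primitives of integrable functions -/

theorem absolutelyContinuousOnInterval_comp_of_lipschitzOnWith {X Y : Type*} [PseudoMetricSpace X]
    [PseudoMetricSpace Y] {f : ℝ → X} {φ : X → Y} {a b : ℝ} {s : Set X} {K : NNReal}
    (hφ : LipschitzOnWith K φ s) (hf : AbsolutelyContinuousOnInterval f a b)
    (hs : MapsTo f (uIcc a b) s) :
    AbsolutelyContinuousOnInterval (φ ∘ f) a b := by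
  rw [absolutelyContinuousOnInterval_iff] at hf ⊢
  intro ε hε
  obtain ⟨δ, hδ, h⟩ := hf (ε / (K + 1)) (by positivity)
  refine ⟨δ, hδ, fun E hE hlt => ?_⟩
  have hsum := h E hE hlt
  rw [lt_div_iff₀ (by positivity), Finset.sum_mul] at hsum
  refine lt_of_le_of_lt (Finset.sum_le_sum fun i hi => ?_) hsum
  have hmem := hE.1 i hi
  calc dist (φ (f (E.2 i).1)) (φ (f (E.2 i).2))
      ≤ K * dist (f (E.2 i).1) (f (E.2 i).2) := hφ.dist_le_mul _ (hs hmem.1) _ (hs hmem.2)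
    _ ≤ dist (f (E.2 i).1) (f (E.2 i).2) * (K + 1) := by
        rw [mul_comm]; gcongr; simp

theorem absolutelyContinuousOnInterval_of_primitive {f g : ℝ → ℝ} {a b c : ℝ}
    (hf : IntervalIntegrable f volume a b)
    (hg : ∀ t ∈ uIcc a b, g t = c + ∫ s in a..t, f s) :
    AbsolutelyContinuousOnInterval g a b := by
  have hc : AbsolutelyContinuousOnInterval (fun _ : ℝ => c) a b :=
    (LipschitzOnWith.of_dist_le_mul (K := 0) (by simp)).absolutelyContinuousOnInterval
  have hG := hc.add (hf.absolutelyContinuousOnInterval_intervalIntegral left_mem_uIcc)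
  rw [absolutelyContinuousOnInterval_iff] at hG ⊢
  intro ε hε
  obtain ⟨δ, hδ, h⟩ := hG ε hε
  refine ⟨δ, hδ, fun E hE hlt => lt_of_eq_of_lt (Finset.sum_congr rfl fun i hi => ?_) (h E hE hlt)⟩
  rw [hg _ (hE.1 i hi).1, hg _ (hE.1 i hi).2]; rfl

theorem continuousOn_of_primitive {f g : ℝ → ℝ} {a b c : ℝ}
    (hf : IntervalIntegrable f volume a b) (hg : ∀ t ∈ uIcc a b, g t = c + ∫ s in a..t, f s) :
    ContinuousOn g (uIcc a b) :=
  ((hf.absolutelyContinuousOnInterval_intervalIntegral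
    left_mem_uIcc).continuousOn.const_add c).congr hg

theorem ae_hasDerivAt_of_primitive {f g : ℝ → ℝ} {a b c : ℝ}
    (hf : IntervalIntegrable f volume a b)
    (hg : ∀ t ∈ uIcc a b, g t = c + ∫ s in a..t, f s) :
    ∀ᵐ t, t ∈ uIoo a b → HasDerivAt g (f t) t := by
  filter_upwards [hf.ae_hasDerivAt_integral] with t ht hmem
  refine ((ht (uIoo_subset_uIcc_self hmem) a left_mem_uIcc).const_add c).congr_of_eventuallyEq ?_
  filter_upwards [isOpen_Ioo.mem_nhds hmem] with s hs using hg s (uIoo_subset_uIcc_self hs)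

theorem ae_eq_zero_of_primitive_eq_zero {f g : ℝ → ℝ} {a b c : ℝ}
    (hf : IntervalIntegrable f volume a b)
    (hg : ∀ t ∈ uIcc a b, g t = c + ∫ s in a..t, f s) (hg0 : ∀ t ∈ uIcc a b, 0 ≤ g t) :
    ∀ᵐ t, t ∈ uIoo a b → g t = 0 → f t = 0 := by
  filter_upwards [ae_hasDerivAt_of_primitive hf hg] with t ht hmem h0
  refine IsLocalMin.hasDerivAt_eq_zero ?_ (ht hmem)
  filter_upwards [isOpen_Ioo.mem_nhds hmem] with s hs
  exact h0.trans_le (hg0 s (uIoo_subset_uIcc_self hs))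

theorem integral_deriv_comp_mul_of_primitive {φ f g : ℝ → ℝ} {a b c : ℝ}
    (hf : IntervalIntegrable f volume a b) (hg : ∀ t ∈ uIcc a b, g t = c + ∫ s in a..t, f s)
    (hφ : ∀ t ∈ uIcc a b, ContDiffAt ℝ 1 φ (g t)) :
    ∫ t in a..b, deriv φ (g t) * f t = φ (g b) - φ (g a) := by
  have hgcont := continuousOn_of_primitive hf hg
  have hφs : ContDiffOn ℝ 1 φ (g '' uIcc a b) := by
    rintro _ ⟨t, ht, rfl⟩
    exact (hφ t ht).contDiffWithinAt
  obtain ⟨K, hK⟩ := hφs.exists_lipschitzOnWith one_ne_zero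
    (isPreconnected_uIcc.image g hgcont).ordConnected.convex
    (isCompact_uIcc.image_of_continuousOn hgcont)
  have hac := absolutelyContinuousOnInterval_comp_of_lipschitzOnWith hK
    (absolutelyContinuousOnInterval_of_primitive hf hg) (mapsTo_image g _)
  refine Eq.trans ?_ hac.integral_deriv_eq_sub
  apply intervalIntegral.integral_congr_ae
  filter_upwards [ae_hasDerivAt_of_primitive hf hg, Measure.ae_ne volume (max a b)]
    with t hderiv htb hmem
  have htu : t ∈ uIoo a b := ⟨hmem.1, hmem.2.lt_of_ne htb⟩
  have hd := ((hφ t (uIoo_subset_uIcc_self htu)).differentiableAt one_ne_zero).hasDerivAt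
  exact (hd.comp t (hderiv htu)).deriv.symm

theorem integral_deriv_negMulLog_comp_add {f g : ℝ → ℝ} {a b c ε : ℝ} (hε : 0 < ε)
    (hf : IntervalIntegrable f volume a b) (hg : ∀ t ∈ uIcc a b, g t = c + ∫ s in a..t, f s)
    (hg0 : ∀ t ∈ uIcc a b, 0 ≤ g t) :
    ∫ t in a..b, (-Real.log (g t + ε) - 1) * f t =
      Real.negMulLog (g b + ε) - Real.negMulLog (g a + ε) := by
  have hne : ∀ t ∈ uIcc a b, g t + ε ≠ 0 := fun t ht => (add_pos_of_nonneg_of_pos (hg0 t ht) hε).ne'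
  have hcomp := integral_deriv_comp_mul_of_primitive (φ := Real.negMulLog) (g := fun t => g t + ε)
    (c := c + ε) hf (fun t ht => by rw [hg t ht]; ring)
    fun t ht => contDiffAt_id.neg.mul (Real.contDiffAt_log.2 (hne t ht))
  rw [← hcomp]
  refine intervalIntegral.integral_congr fun t ht => ?_
  simp only [Real.deriv_negMulLog (hne t ht)]

/-- Fatou's lemma makes the limit integrable, so that the limit itself may enter the dominating
function. -/
theorem integrable_and_integral_eq_of_tendsto {α : Type*} [MeasurableSpace α] {μ : Measure α}
    {G : ℕ → α → ℝ} {f g : α → ℝ} {L : ℝ}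
    (hG : ∀ k, Integrable (G k) μ) (hg : Integrable g μ)
    (hlim : ∀ᵐ t ∂μ, Tendsto (fun k => G k t) atTop (𝓝 (f t)))
    (hmem : ∀ᵐ t ∂μ, ∀ k, G k t ∈ Icc (-g t) (g t + f t))
    (hL : Tendsto (fun k => ∫ t, G k t ∂μ) atTop (𝓝 L)) :
    Integrable f μ ∧ ∫ t, f t ∂μ = L := by
  have hnorm : ∀ k, eLpNorm (G k) 1 μ ≤ ENNReal.ofReal (∫ t, G k t ∂μ + 2 * ∫ t, |g t| ∂μ) := by
    intro k
    rw [eLpNorm_one_eq_lintegral_enorm, ← ofReal_integral_norm_eq_lintegral_enorm (hG k),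
      ← integral_const_mul, ← integral_add (hG k) (hg.abs.const_mul 2)]
    refine ENNReal.ofReal_le_ofReal (integral_mono_ae (hG k).norm
      ((hG k).add (hg.abs.const_mul 2)) ?_)
    filter_upwards [hmem] with t ht
    have := (ht k).1
    simp only [Real.norm_eq_abs, abs_le]
    constructor <;> linarith [le_abs_self (g t), abs_nonneg (g t)]
  have hmeas : ∀ k, AEStronglyMeasurable (G k) μ := fun k => (hG k).aestronglyMeasurable
  have hf : Integrable f μ := by
    have hbound := (ENNReal.tendsto_ofReal (hL.add_const (2 * ∫ t, |g t| ∂μ))).liminf_eq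
    refine memLp_one_iff_integrable.1 ⟨aestronglyMeasurable_of_tendsto_ae _ hmeas hlim, ?_⟩
    calc eLpNorm f 1 μ
        ≤ liminf (fun k => eLpNorm (G k) 1 μ) atTop :=
          Lp.eLpNorm_lim_le_liminf_eLpNorm hmeas f hlim
      _ ≤ _ := liminf_le_liminf (Eventually.of_forall hnorm)
      _ < ⊤ := hbound.trans_lt ENNReal.ofReal_lt_top
  refine ⟨hf, tendsto_nhds_unique (tendsto_integral_of_dominated_convergence
    (fun t => |g t| + |f t|) hmeas (hg.abs.add hf.abs)
    (fun k => ?_) hlim) hL⟩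
  filter_upwards [hmem] with t ht
  obtain ⟨hl, hu⟩ := ht k
  rw [Real.norm_eq_abs, abs_le]
  constructor <;> linarith [le_abs_self (g t), le_abs_self (f t), abs_nonneg (f t)]

/-! ### Entropy production -/

theorem sum_sum_eq_half_sum_add_swap {ι : Type*} [Fintype ι] (G : ι → ι → ℝ) :
    ∑ x, ∑ u, G x u = (1 / 2) * ∑ x, ∑ u, (G x u + G u x) := by
  have hswap : ∑ x, ∑ u, G u x = ∑ x, ∑ u, G x u := Finset.sum_comm
  simp only [Finset.sum_add_distrib, hswap]
  ring

theorem sum_sum_eq_zero_of_antisymm {ι : Type*} [Fintype ι] {G : ι → ι → ℝ}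
    (h : ∀ x u, G u x = -G x u) : ∑ x, ∑ u, G x u = 0 := by
  rw [sum_sum_eq_half_sum_add_swap]
  simp only [fun x u => (add_eq_zero_iff_eq_neg'.2 (h x u) : G x u + G u x = 0),
    Finset.sum_const_zero, mul_zero]

theorem log_add_sub_log_add_mem_uIcc {a b ε : ℝ} (ha : 0 < a) (hb : 0 < b) (hε : 0 ≤ ε) :
    Real.log (a + ε) - Real.log (b + ε) ∈ uIcc 0 (Real.log a - Real.log b) := by
  wlog hab : b ≤ a generalizing a b
  · have h := this hb ha (le_of_not_ge hab)
    rw [mem_uIcc] at h ⊢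
    grind
  have hlow : Real.log (b + ε) ≤ Real.log (a + ε) := Real.log_le_log (by positivity) (by linarith)
  have hupp : Real.log (a + ε) - Real.log (b + ε) ≤ Real.log a - Real.log b := by
    rw [← Real.log_div (by positivity) (by positivity), ← Real.log_div ha.ne' hb.ne']
    apply Real.log_le_log (by positivity)
    rw [div_le_div_iff₀ (by positivity) hb]
    nlinarith
  exact mem_uIcc_of_le (sub_nonneg.2 hlow) hupp

theorem sub_mul_log_div_nonneg {a b : ℝ} (ha : 0 < a) (hb : 0 < b) :
    0 ≤ (a - b) * Real.log (a / b) := by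
  rw [Real.log_div ha.ne' hb.ne']
  rcases le_total a b with h | h
  · exact mul_nonneg_of_nonpos_of_nonpos (by linarith) (by linarith [Real.log_le_log ha h])
  · exact mul_nonneg (by linarith) (by linarith [Real.log_le_log hb h])

theorem marginalY_initialDist {n : ℕ} (pY : Fin n → ℝ) : marginalY (initialDist pY) = pY := by
  ext y
  simp [marginalY, initialDist]

namespace FeedbackProcess

variable {n : ℕ} {N : Fin n → SimpleGraph (Fin n)} {pY : Fin n → ℝ} {τ : ℝ}

/-- `ln (R(x,u) / R(u,x))`, the entropy given to the environment in a transition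
`(u, y) → (x, y)`. -/
def logRatio (P : FeedbackProcess N pY τ) (t : ℝ) (y x u : Fin n) : ℝ :=
  Real.log (P.rate t y x u / P.rate t y u x)

/-- The thermodynamic force for probabilities raised by `ε`, which unlike `force` is integrable
against the current. -/
def shiftedForce (P : FeedbackProcess N pY τ) (ε t : ℝ) (y x u : Fin n) : ℝ :=
  P.logRatio t y x u + (Real.log (P.prob t u y + ε) - Real.log (P.prob t x y + ε))

/-- Entropy production rate of the composite system: currents times forces, each pair of opposite
transitions being counted once. -/
def dissipation (P : FeedbackProcess N pY τ) (t : ℝ) : ℝ :=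
  (1 / 2) * ∑ y, ∑ x, ∑ u, P.current t y x u * P.force t y x u

/-- Total entropy production of the composite system and its environment. -/
def totalProduction (P : FeedbackProcess N pY τ) : ℝ :=
  shannon (fun z : Fin n × Fin n => P.prob τ z.1 z.2) -
    shannon (fun z : Fin n × Fin n => P.prob 0 z.1 z.2) +
    ∫ t in Ioo 0 τ, ∑ y, ∑ x, ∑ u, P.logRatio t y x u * P.jump t y x u

variable (P : FeedbackProcess N pY τ)

theorem logRatio_swap (t : ℝ) (y x u : Fin n) : P.logRatio t y u x = -P.logRatio t y x u := by
  rw [logRatio, logRatio, ← Real.log_inv, inv_div]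

theorem current_swap (t : ℝ) (y x u : Fin n) : P.current t y u x = -P.current t y x u := by
  simp [current]

theorem force_swap (t : ℝ) (y x u : Fin n) : P.force t y u x = -P.force t y x u := by
  rw [force, force, ← Real.log_inv, inv_div]

theorem jump_nonneg {t : ℝ} (ht : t ∈ Ioo 0 τ) (y x u : Fin n) : 0 ≤ P.jump t y x u :=
  mul_nonneg (P.rate_nonneg t ht y x u) (P.prob_nonneg t (Ioo_subset_Icc_self ht) u y)

theorem jump_self {t : ℝ} (ht : t ∈ Ioo 0 τ) (y x : Fin n) : P.jump t y x x = 0 := by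
  rw [jump, P.rate_eq_zero t ht y x x (SimpleGraph.irrefl _), zero_mul]

theorem integrableOn_jump (hτ : 0 ≤ τ) (y x u : Fin n) :
    IntegrableOn (fun t => P.jump t y x u) (Ioo 0 τ) :=
  (intervalIntegrable_iff_integrableOn_Ioo_of_le hτ).1 (P.jump_integrable y x u)

theorem integrableOn_current (hτ : 0 ≤ τ) (y x u : Fin n) :
    IntegrableOn (fun t => P.current t y x u) (Ioo 0 τ) :=
  (P.integrableOn_jump hτ y x u).sub (P.integrableOn_jump hτ y u x)

theorem integrableOn_logRatio_mul_jump (hτ : 0 ≤ τ) (y x u : Fin n) :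
    IntegrableOn (fun t => P.logRatio t y x u * P.jump t y x u) (Ioo 0 τ) :=
  (intervalIntegrable_iff_integrableOn_Ioo_of_le hτ).1 (P.heat_integrable y x u)

theorem integrableOn_current_mul_logRatio (hτ : 0 ≤ τ) (y x u : Fin n) :
    IntegrableOn (fun t => P.current t y x u * P.logRatio t y x u) (Ioo 0 τ) := by
  refine ((P.integrableOn_logRatio_mul_jump hτ y x u).add
    (P.integrableOn_logRatio_mul_jump hτ y u x)).congr (Eventually.of_forall fun t => ?_)
  simp only [Pi.add_apply, current, P.logRatio_swap t y x u]
  ring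

theorem intervalIntegrable_sum_current (y x : Fin n) :
    IntervalIntegrable (fun t => ∑ u, P.current t y x u) volume 0 τ := by
  simpa only [Finset.sum_fn] using IntervalIntegrable.sum (f := fun u t => P.current t y x u)
    Finset.univ fun u _ => (P.jump_integrable y x u).sub (P.jump_integrable y u x)

theorem prob_eq {t : ℝ} (hτ : 0 ≤ τ) (ht : t ∈ uIcc 0 τ) (x y : Fin n) :
    P.prob t x y = P.prob 0 x y + ∫ s in (0 : ℝ)..t, ∑ u, P.current s y x u :=
  P.master t (by rwa [uIcc_of_le hτ] at ht) x y

theorem prob_nonneg_of_mem_uIcc {t : ℝ} (hτ : 0 ≤ τ) (ht : t ∈ uIcc 0 τ) (x y : Fin n) :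
    0 ≤ P.prob t x y :=
  P.prob_nonneg t (by rwa [uIcc_of_le hτ] at ht) x y

/-- A state of zero probability has vanishing net inflow, because `prob` is nonnegative and hence
minimal there; the inflow itself then vanishes, there being no outflow. -/
theorem ae_prob_pos_of_jump_pos (hτ : 0 ≤ τ) : ∀ᵐ t ∂volume.restrict (Ioo 0 τ), ∀ y x u,
    0 < P.jump t y x u → 0 < P.prob t x y := by
  have hinflow : ∀ᵐ t, ∀ y x, t ∈ uIoo 0 τ → P.prob t x y = 0 → ∑ u, P.current t y x u = 0 :=
    ae_all_iff.2 fun y => ae_all_iff.2 fun x => ae_eq_zero_of_primitive_eq_zero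
      (P.intervalIntegrable_sum_current y x) (fun t ht => P.prob_eq hτ ht x y)
      fun t ht => P.prob_nonneg_of_mem_uIcc hτ ht x y
  rw [ae_restrict_iff' measurableSet_Ioo]
  filter_upwards [hinflow] with t ht hmem y x u hj
  refine (P.prob_nonneg t (Ioo_subset_Icc_self hmem) x y).lt_of_ne' fun h0 => hj.ne' ?_
  have hzero : ∑ v, P.jump t y x v = 0 := by
    simpa [current, jump, h0] using ht y x (by rwa [uIoo_of_le hτ]) h0
  exact (Finset.sum_eq_zero_iff_of_nonneg fun v _ => P.jump_nonneg hmem y x v).1 hzero u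
    (Finset.mem_univ u)

theorem ae_pos_of_current_ne_zero (hτ : 0 ≤ τ) : ∀ᵐ t ∂volume.restrict (Ioo 0 τ), ∀ y x u,
    P.current t y x u ≠ 0 →
      (0 < P.rate t y x u ∧ 0 < P.prob t u y) ∧ 0 < P.rate t y u x ∧ 0 < P.prob t x y := by
  filter_upwards [P.ae_prob_pos_of_jump_pos hτ, ae_restrict_mem measurableSet_Ioo]
    with t hprob ht
  have hpos : ∀ y x u, 0 < P.jump t y x u →
      (0 < P.rate t y x u ∧ 0 < P.prob t u y) ∧ 0 < P.rate t y u x ∧ 0 < P.prob t x y := by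
    intro y x u hj
    have hR := (P.rate_nonneg t ht y x u).lt_of_ne' (left_ne_zero_of_mul hj.ne')
    have hp := (P.prob_nonneg t (Ioo_subset_Icc_self ht) u y).lt_of_ne'
      (right_ne_zero_of_mul hj.ne')
    exact ⟨⟨hR, hp⟩, P.rate_pos_symm t ht y x u hR, hprob y x u hj⟩
  intro y x u hJ
  rcases (P.jump_nonneg ht y x u).lt_or_eq with h | h
  · exact hpos y x u h
  · refine (hpos y u x ((P.jump_nonneg ht y u x).lt_of_ne' fun h' => hJ ?_)).symm
    rw [current, ← h, h', sub_zero]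

theorem force_eq {t : ℝ} {y x u : Fin n} (hf : 0 < P.rate t y x u ∧ 0 < P.prob t u y)
    (hb : 0 < P.rate t y u x ∧ 0 < P.prob t x y) :
    P.force t y x u = P.shiftedForce 0 t y x u := by
  obtain ⟨hR, hp⟩ := hf
  obtain ⟨hR', hp'⟩ := hb
  rw [force, shiftedForce, logRatio, jump, jump, Real.log_div (by positivity) (by positivity),
    Real.log_div hR.ne' hR'.ne', Real.log_mul hR.ne' hp.ne', Real.log_mul hR'.ne' hp'.ne',
    add_zero, add_zero]
  ring

theorem ae_tendsto_current_mul_shiftedForce (hτ : 0 ≤ τ) : ∀ᵐ t ∂volume.restrict (Ioo 0 τ),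
    ∀ y x u, Tendsto (fun ε => P.current t y x u * P.shiftedForce ε t y x u) (𝓝 0)
      (𝓝 (P.current t y x u * P.force t y x u)) := by
  filter_upwards [P.ae_pos_of_current_ne_zero hτ] with t ht y x u
  by_cases hJ : P.current t y x u = 0
  · simp [hJ]
  obtain ⟨hf, hb⟩ := ht y x u hJ
  have hlog : ∀ {a : ℝ}, 0 < a → ContinuousAt (fun ε => Real.log (a + ε)) 0 := fun ha =>
    ContinuousAt.log (by fun_prop) (by simpa using ha.ne')
  rw [P.force_eq hf hb]
  exact (((hlog hf.2).sub (hlog hb.2)).const_add _).const_mul _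

theorem ae_current_mul_shiftedForce_mem_Icc (hτ : 0 ≤ τ) : ∀ᵐ t ∂volume.restrict (Ioo 0 τ),
    ∀ y x u, ∀ ε ≥ 0, P.current t y x u * P.shiftedForce ε t y x u ∈
      Icc (-|P.current t y x u * P.logRatio t y x u|)
        (|P.current t y x u * P.logRatio t y x u| + P.current t y x u * P.force t y x u) := by
  filter_upwards [P.ae_pos_of_current_ne_zero hτ] with t ht y x u ε hε
  by_cases hJ : P.current t y x u = 0
  · simp [hJ]
  obtain ⟨hf, hb⟩ := ht y x u hJ
  have hnonneg : 0 ≤ P.current t y x u * P.force t y x u :=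
    sub_mul_log_div_nonneg (mul_pos hf.1 hf.2) (mul_pos hb.1 hb.2)
  have hbetween : P.current t y x u * P.shiftedForce ε t y x u ∈
      uIcc (P.current t y x u * P.logRatio t y x u) (P.current t y x u * P.force t y x u) := by
    rw [P.force_eq hf hb, ← image_const_mul_uIcc]
    refine mem_image_of_mem _ ?_
    have hlog := log_add_sub_log_add_mem_uIcc hf.2 hb.2 hε
    rw [mem_uIcc] at hlog ⊢
    simp only [shiftedForce, add_zero]
    rcases hlog with h | h
    · exact .inl ⟨by linarith, by linarith⟩
    · exact .inr ⟨by linarith, by linarith⟩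
  rw [mem_uIcc] at hbetween
  have hneg := neg_abs_le (P.current t y x u * P.logRatio t y x u)
  have hpos := le_abs_self (P.current t y x u * P.logRatio t y x u)
  constructor <;> rcases hbetween with h | h <;> linarith
theorem integrableOn_current_mul_log_prob_add (hτ : 0 ≤ τ) {ε : ℝ} (hε : 0 < ε)
    (y x u v : Fin n) :
    IntegrableOn (fun t => P.current t y x u * Real.log (P.prob t v y + ε)) (Ioo 0 τ) := by
  rw [← intervalIntegrable_iff_integrableOn_Ioo_of_le hτ]
  refine ((P.jump_integrable y x u).sub (P.jump_integrable y u x)).mul_continuousOn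
    (((continuousOn_of_primitive (P.intervalIntegrable_sum_current y v)
      fun t ht => P.prob_eq hτ ht v y).add_const ε).log fun t ht => ?_)
  exact (add_pos_of_nonneg_of_pos (P.prob_nonneg_of_mem_uIcc hτ ht v y) hε).ne'

theorem integrableOn_current_mul_shiftedForce (hτ : 0 ≤ τ) {ε : ℝ} (hε : 0 < ε) (y x u : Fin n) :
    IntegrableOn (fun t => P.current t y x u * P.shiftedForce ε t y x u) (Ioo 0 τ) := by
  refine ((P.integrableOn_current_mul_logRatio hτ y x u).add
    ((P.integrableOn_current_mul_log_prob_add hτ hε y x u u).sub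
      (P.integrableOn_current_mul_log_prob_add hτ hε y x u x))).congr
    (Eventually.of_forall fun t => ?_)
  simp only [Pi.add_apply, Pi.sub_apply, shiftedForce]
  ring

theorem half_sum_current_mul_shiftedForce (ε t : ℝ) :
    (1 / 2) * ∑ y, ∑ x, ∑ u, P.current t y x u * P.shiftedForce ε t y x u =
      (∑ y, ∑ x, (-Real.log (P.prob t x y + ε) - 1) * ∑ u, P.current t y x u) +
        ∑ y, ∑ x, ∑ u, P.logRatio t y x u * P.jump t y x u := by
  simp only [Finset.mul_sum (s := Finset.univ) (f := fun u => P.current _ _ _ u),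
    ← Finset.sum_add_distrib]
  rw [Finset.mul_sum]
  refine Finset.sum_congr rfl fun y _ => ?_
  rw [sum_sum_eq_half_sum_add_swap (fun x u => _ * _ + _ * _)]
  congr 1
  refine Finset.sum_congr rfl fun x _ => Finset.sum_congr rfl fun u _ => ?_
  simp only [shiftedForce, P.logRatio_swap t y x u, current]
  ring

theorem integral_half_sum_current_mul_shiftedForce (hτ : 0 ≤ τ) {ε : ℝ} (hε : 0 < ε) :
    ∫ t in Ioo 0 τ, (1 / 2) * ∑ y, ∑ x, ∑ u, P.current t y x u * P.shiftedForce ε t y x u =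
      ∑ y, ∑ x, (Real.negMulLog (P.prob τ x y + ε) - Real.negMulLog (P.prob 0 x y + ε)) +
        ∫ t in Ioo 0 τ, ∑ y, ∑ x, ∑ u, P.logRatio t y x u * P.jump t y x u := by
  have hentropy : ∀ y x, ∫ t in Ioo 0 τ,
      (-Real.log (P.prob t x y + ε) - 1) * ∑ u, P.current t y x u =
        Real.negMulLog (P.prob τ x y + ε) - Real.negMulLog (P.prob 0 x y + ε) := by
    intro y x
    rw [← integral_deriv_negMulLog_comp_add hε (P.intervalIntegrable_sum_current y x)
      (fun t ht => P.prob_eq hτ ht x y) fun t ht => P.prob_nonneg_of_mem_uIcc hτ ht x y,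
      intervalIntegral.integral_of_le hτ, integral_Ioc_eq_integral_Ioo]
  have hint : ∀ y x, IntegrableOn
      (fun t => (-Real.log (P.prob t x y + ε) - 1) * ∑ u, P.current t y x u) (Ioo 0 τ) := by
    intro y x
    refine (integrable_finsetSum Finset.univ fun u _ =>
      ((P.integrableOn_current_mul_log_prob_add hτ hε y x u x).neg.sub
        (P.integrableOn_current hτ y x u))).congr (Eventually.of_forall fun t => ?_)
    simp only [Pi.sub_apply, Pi.neg_apply, Finset.mul_sum]
    exact Finset.sum_congr rfl fun u _ => by ring
  simp only [half_sum_current_mul_shiftedForce, ← hentropy]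
  rw [integral_add, integral_finsetSum]
  · congr 1
    exact Finset.sum_congr rfl fun y _ => integral_finsetSum _ fun x _ => hint y x
  · exact fun y _ => integrable_finsetSum _ fun x _ => hint y x
  · exact integrable_finsetSum _ fun y _ => integrable_finsetSum _ fun x _ => hint y x
  · exact integrable_finsetSum _ fun y _ => integrable_finsetSum _ fun x _ =>
      integrable_finsetSum _ fun u _ => P.integrableOn_logRatio_mul_jump hτ y x u

theorem tendsto_integral_half_sum_current_mul_shiftedForce (hτ : 0 ≤ τ) :
    Tendsto (fun ε => ∫ t in Ioo 0 τ,
      (1 / 2) * ∑ y, ∑ x, ∑ u, P.current t y x u * P.shiftedForce ε t y x u) (𝓝[>] 0)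
      (𝓝 P.totalProduction) := by
  set B := ∫ t in Ioo 0 τ, ∑ y, ∑ x, ∑ u, P.logRatio t y x u * P.jump t y x u with hB
  have hcont : Continuous fun ε => ∑ y, ∑ x, (Real.negMulLog (P.prob τ x y + ε) -
      Real.negMulLog (P.prob 0 x y + ε)) + B := by fun_prop
  have hlim := (hcont.tendsto 0).mono_left (nhdsWithin_le_nhds (s := Ioi 0))
  have hzero : ∑ y, ∑ x, (Real.negMulLog (P.prob τ x y + 0) -
      Real.negMulLog (P.prob 0 x y + 0)) + B = P.totalProduction := by
    simp only [totalProduction, shannon, Fintype.sum_prod_type_right, add_zero,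
      Finset.sum_sub_distrib, hB]
  rw [hzero] at hlim
  refine hlim.congr' ?_
  filter_upwards [self_mem_nhdsWithin] with ε hε
  exact (P.integral_half_sum_current_mul_shiftedForce hτ hε).symm

/-- Forces may diverge where probabilities vanish, hence the detour through `shiftedForce`. -/
theorem integrableOn_dissipation_and_integral_eq (hτ : 0 ≤ τ) :
    IntegrableOn P.dissipation (Ioo 0 τ) ∧ ∫ t in Ioo 0 τ, P.dissipation t = P.totalProduction := by
  set ε : ℕ → ℝ := fun k => 1 / (k + 1)
  have hεpos : ∀ k, 0 < ε k := fun k => Nat.one_div_pos_of_nat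
  have hεlim : Tendsto ε atTop (𝓝[>] 0) :=
    tendsto_nhdsWithin_iff.2 ⟨tendsto_one_div_add_atTop_nhds_zero_nat, .of_forall hεpos⟩
  refine integrable_and_integral_eq_of_tendsto
    (G := fun k t => (1 / 2) * ∑ y, ∑ x, ∑ u, P.current t y x u * P.shiftedForce (ε k) t y x u)
    (g := fun t => (1 / 2) * ∑ y, ∑ x, ∑ u, |P.current t y x u * P.logRatio t y x u|)
    (fun k => ?_) ?_ ?_ ?_ ((P.tendsto_integral_half_sum_current_mul_shiftedForce hτ).comp hεlim)
  · exact (integrable_finsetSum _ fun y _ => integrable_finsetSum _ fun x _ =>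
      integrable_finsetSum _ fun u _ =>
        P.integrableOn_current_mul_shiftedForce hτ (hεpos k) y x u).const_mul _
  · exact (integrable_finsetSum _ fun y _ => integrable_finsetSum _ fun x _ =>
      integrable_finsetSum _ fun u _ =>
        (P.integrableOn_current_mul_logRatio hτ y x u).abs).const_mul _
  · filter_upwards [P.ae_tendsto_current_mul_shiftedForce hτ] with t ht
    exact Tendsto.const_mul _ (tendsto_finsetSum _ fun y _ => tendsto_finsetSum _ fun x _ =>
      tendsto_finsetSum _ fun u _ => (ht y x u).comp (hεlim.mono_right nhdsWithin_le_nhds))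
  · filter_upwards [P.ae_current_mul_shiftedForce_mem_Icc hτ] with t ht k
    have hmem := fun y x u => ht y x u (ε k) (hεpos k).le
    rw [dissipation, ← mul_neg, ← mul_add]
    simp only [← Finset.sum_neg_distrib, ← Finset.sum_add_distrib]
    constructor <;> gcongr with y _ x _ u
    exacts [(hmem y x u).1, (hmem y x u).2]

theorem integrableOn_dissipation (hτ : 0 ≤ τ) : IntegrableOn P.dissipation (Ioo 0 τ) :=
  (P.integrableOn_dissipation_and_integral_eq hτ).1

theorem integral_dissipation (hτ : 0 ≤ τ) : ∫ t in Ioo 0 τ, P.dissipation t = P.totalProduction :=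
  (P.integrableOn_dissipation_and_integral_eq hτ).2

theorem marginalY_prob {t : ℝ} (ht : t ∈ Icc 0 τ) : marginalY (P.prob t) = pY := by
  have hτ := ht.1.trans ht.2
  have hnet : ∀ y, ∑ x, ∫ s in (0 : ℝ)..t, ∑ u, P.current s y x u = 0 := by
    intro y
    rw [← intervalIntegral.integral_finsetSum fun x _ =>
      (P.intervalIntegrable_sum_current y x).mono_set (uIcc_subset_uIcc_left (by
        rwa [uIcc_of_le hτ]))]
    simp only [sum_sum_eq_zero_of_antisymm fun x u => P.current_swap _ y x u,
      intervalIntegral.integral_zero]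
  ext y
  simp only [marginalY, P.prob_eq hτ (by rwa [uIcc_of_le hτ] : t ∈ uIcc 0 τ), P.prob_zero,
    Finset.sum_add_distrib, hnet, add_zero]
  exact congrFun (marginalY_initialDist pY) y

theorem beta_mul_heat (hτ : 0 ≤ τ) {β : ℝ} (hβ : β ≠ 0) :
    β * P.heat β = -∫ t in Ioo 0 τ, ∑ y, ∑ x, ∑ u, P.logRatio t y x u * P.jump t y x u := by
  rw [heat, intervalIntegral.integral_of_le hτ, integral_Ioc_eq_integral_Ioo,
    ← integral_const_mul, ← integral_neg]
  congr 1
  ext t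
  simp only [Finset.mul_sum, ← Finset.sum_neg_distrib, stochasticHeat, logRatio]
  field_simp

theorem entropyProduction_eq (hτ : 0 ≤ τ) {β : ℝ} (hβ : β ≠ 0) :
    P.entropyProduction β = P.totalProduction + P.infoChange := by
  rw [entropyProduction, P.beta_mul_heat hτ hβ, totalProduction, infoChange, mutualInfo,
    mutualInfo, P.marginalY_prob ⟨hτ, le_rfl⟩, P.marginalY_prob ⟨le_rfl, hτ⟩]
  ring

theorem activity_eq {t : ℝ} (ht : t ∈ Ioo 0 τ) :
    P.activity t = ∑ y, ∑ x, ∑ u, P.jump t y x u := by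
  simp only [activity]
  refine Finset.sum_congr rfl fun y _ => Finset.sum_congr rfl fun x _ =>
    Finset.sum_congr rfl fun u _ => ?_
  split_ifs with h
  · rfl
  · rw [not_not.1 h, P.jump_self ht]

theorem activity_eq_half_sum {t : ℝ} (ht : t ∈ Ioo 0 τ) :
    P.activity t = (1 / 2) * ∑ y, ∑ x, ∑ u, (P.jump t y x u + P.jump t y u x) := by
  rw [P.activity_eq ht, Finset.mul_sum]
  exact Finset.sum_congr rfl fun y _ => sum_sum_eq_half_sum_add_swap _

theorem integrableOn_activity (hτ : 0 ≤ τ) : IntegrableOn P.activity (Ioo 0 τ) :=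
  (integrableOn_congr_fun (fun _ ht => P.activity_eq ht) measurableSet_Ioo).2 <|
    integrable_finsetSum _ fun y _ => integrable_finsetSum _ fun x _ =>
      integrable_finsetSum _ fun u _ => P.integrableOn_jump hτ y x u

theorem integral_activity (hτ : 0 < τ) : ∫ t in Ioo 0 τ, P.activity t = τ * P.meanActivity := by
  rw [meanActivity, mul_div_cancel₀ _ hτ.ne', intervalIntegral.integral_of_le hτ.le,
    integral_Ioc_eq_integral_Ioo]

/-- Rate at which probability leaves the error-free states `(y, y)`. -/
def outflow (P : FeedbackProcess N pY τ) (t : ℝ) : ℝ := ∑ y, ∑ u, P.current t y u y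

/-- Orientation of the transition `(u, y) → (x, y)` relative to the error-free state: `1` if it
leaves `(y, y)`, `-1` if it enters `(y, y)`, and `0` otherwise. -/
def outSign (y x u : Fin n) : ℝ := (if u = y then 1 else 0) - (if x = y then 1 else 0)

theorem outSign_mem_Icc (y x u : Fin n) : outSign y x u ∈ Icc (-1) 1 := by
  rw [outSign]
  split_ifs <;> norm_num

theorem outflow_eq_half_sum (t : ℝ) :
    P.outflow t = (1 / 2) * ∑ y, ∑ x, ∑ u, outSign y x u * P.current t y x u := by
  rw [outflow, Finset.mul_sum]
  refine Finset.sum_congr rfl fun y _ => ?_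
  simp only [outSign, sub_mul, ite_mul, one_mul, zero_mul, Finset.sum_sub_distrib]
  rw [Finset.sum_comm (f := fun x u => if x = y then P.current t y x u else 0)]
  simp only [Finset.sum_ite_eq', Finset.mem_univ, if_true, P.current_swap t y _ y,
    Finset.sum_neg_distrib]
  ring

theorem integrableOn_outflow (hτ : 0 ≤ τ) : IntegrableOn P.outflow (Ioo 0 τ) :=
  integrable_finsetSum _ fun y _ => integrable_finsetSum _ fun u _ =>
    P.integrableOn_current hτ y u y

theorem integral_outflow (hτ : 0 ≤ τ) :
    ∫ t in Ioo 0 τ, P.outflow t = ∑ y, pY y - ∑ y, P.prob τ y y := by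
  have hloss : ∀ y, ∫ t in Ioo 0 τ, ∑ u, P.current t y u y = pY y - P.prob τ y y := by
    intro y
    rw [P.prob_eq hτ right_mem_uIcc, P.prob_zero, initialDist, if_pos rfl,
      intervalIntegral.integral_of_le hτ, integral_Ioc_eq_integral_Ioo, sub_add_cancel_left,
      ← integral_neg]
    simp only [← Finset.sum_neg_distrib, P.current_swap _ y _ y]
    simp
  simp only [outflow, ← Finset.sum_sub_distrib, ← hloss]
  exact integral_finsetSum _ fun y _ => integrable_finsetSum _ fun u _ =>
    P.integrableOn_current hτ y u y

end FeedbackProcess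

/-! ### The tangent bound -/

/-- The left-hand side is the tangent of the dissipation, a convex function of the two jump
probabilities `a` and `b`, at all points with force `F = log (a / b)`. -/
theorem tangent_le_sub_mul_log_div {a b : ℝ} (ha : 0 < a) (hb : 0 < b) (F : ℝ) :
    (F + Real.sinh F) * (a - b) - (Real.cosh F - 1) * (a + b) ≤ (a - b) * Real.log (a / b) := by
  have half : ∀ {a b : ℝ} (F : ℝ), 0 < a → 0 < b →
      a * (1 + F) - b * Real.exp F ≤ a * Real.log (a / b) := by
    intro a b F ha hb
    have hlog := Real.one_sub_inv_le_log_of_pos (show 0 < a / b * Real.exp (-F) by positivity)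
    rw [Real.log_mul (by positivity) (by positivity), Real.log_exp] at hlog
    have hinv : a * (1 - (a / b * Real.exp (-F))⁻¹) = a - b * Real.exp F := by
      rw [Real.exp_neg]; field_simp
    linarith [mul_le_mul_of_nonneg_left hlog ha.le]
  have hab := half F ha hb
  have hba := half (-F) hb ha
  rw [← inv_div, Real.log_inv] at hba
  rw [Real.sinh_eq, Real.cosh_eq]
  linarith

/-- The bound is affine in `s`, so it suffices to use the tangents for `F` and `-F`. -/
theorem signed_tangent_le_sub_mul_log_div {a b s : ℝ} (ha : 0 < a) (hb : 0 < b)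
    (hs : s ∈ Icc (-1) 1) (F : ℝ) :
    (F + Real.sinh F) * (s * (a - b)) - (Real.cosh F - 1) * (a + b) ≤
      (a - b) * Real.log (a / b) := by
  have hforward := tangent_le_sub_mul_log_div ha hb F
  have hbackward := tangent_le_sub_mul_log_div ha hb (-F)
  rw [Real.sinh_neg, Real.cosh_neg] at hbackward
  nlinarith [mul_le_mul_of_nonneg_left hforward (by linarith [hs.1] : 0 ≤ (1 + s) / 2),
    mul_le_mul_of_nonneg_left hbackward (by linarith [hs.2] : 0 ≤ (1 - s) / 2)]

theorem lt_of_forall_tangent_le {W T s : ℝ} (hW : 0 < W)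
    (h : ∀ F, 0 ≤ F → (F + Real.sinh F) * W - (Real.cosh F - 1) * T ≤ s) : W < T := by
  by_contra! hTW
  have hlinear : ∀ F, 0 ≤ F → F * W ≤ s := by
    intro F hF
    have hexp : Real.exp (-F) ≤ 1 := Real.exp_le_one_iff.2 (by linarith)
    have hcosh := Real.one_le_cosh F
    have hdiff := Real.cosh_sub_sinh F
    refine le_trans ?_ (h F hF)
    nlinarith
  have hbig := hlinear ((|s| + 1) / W) (by positivity)
  rw [div_mul_cancel₀ _ hW.ne'] at hbig
  linarith [le_abs_self s]

theorem tangent_two_mul_artanh {W T : ℝ} (hW : 0 ≤ W) (hWT : W < T) :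
    (2 * Real.artanh (W / T) + Real.sinh (2 * Real.artanh (W / T))) * W -
      (Real.cosh (2 * Real.artanh (W / T)) - 1) * T = 2 * W * Real.artanh (W / T) := by
  have hT : 0 < T := hW.trans_lt hWT
  have hmem : W / T ∈ Ioo (-1) 1 :=
    ⟨by linarith [div_nonneg hW hT.le], (div_lt_one hT).2 hWT⟩
  set a := Real.artanh (W / T)
  have htanh : Real.tanh a = W / T := Real.tanh_artanh hmem
  rw [Real.tanh_eq_sinh_div_cosh, div_eq_div_iff (Real.cosh_pos a).ne' hT.ne'] at htanh
  rw [Real.sinh_two_mul, Real.cosh_two_mul, Real.cosh_sq]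
  linear_combination -2 * Real.sinh a * htanh

theorem div_mem_Ico_and_artanh_le_of_forall_tangent_le {E T W s : ℝ} (hW : 0 ≤ W) (hWE : W ≤ E)
    (h : ∀ F, 0 ≤ F → (F + Real.sinh F) * E - (Real.cosh F - 1) * T ≤ s) :
    W / T ∈ Ico 0 1 ∧ 2 * W * Real.artanh (W / T) ≤ s := by
  have hW_tangent : ∀ F, 0 ≤ F → (F + Real.sinh F) * W - (Real.cosh F - 1) * T ≤ s := by
    intro F hF
    refine le_trans ?_ (h F hF)
    have := Real.sinh_nonneg_iff.2 hF
    gcongr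
  rcases hW.eq_or_lt with rfl | hWpos
  · simpa using hW_tangent 0 le_rfl
  have hWT : W < T := lt_of_forall_tangent_le hWpos hW_tangent
  have hr : 0 ≤ W / T := div_nonneg hW (hW.trans hWT.le)
  refine ⟨⟨hr, (div_lt_one (hWpos.trans hWT)).2 hWT⟩, ?_⟩
  rw [← tangent_two_mul_artanh hW hWT]
  exact hW_tangent _ (mul_nonneg zero_le_two (Real.artanh_nonneg hr))

namespace FeedbackProcess

variable {n : ℕ} {N : Fin n → SimpleGraph (Fin n)} {pY : Fin n → ℝ} {τ : ℝ}
  (P : FeedbackProcess N pY τ)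

theorem ae_signed_tangent_le_current_mul_force (hτ : 0 ≤ τ) (F : ℝ) :
    ∀ᵐ t ∂volume.restrict (Ioo 0 τ), ∀ y x u,
      (F + Real.sinh F) * (outSign y x u * P.current t y x u) -
        (Real.cosh F - 1) * (P.jump t y x u + P.jump t y u x) ≤
          P.current t y x u * P.force t y x u := by
  filter_upwards [P.ae_pos_of_current_ne_zero hτ, ae_restrict_mem measurableSet_Ioo]
    with t hpos ht y x u
  by_cases hJ : P.current t y x u = 0
  · have hcosh := Real.one_le_cosh F
    have hjumps := add_nonneg (P.jump_nonneg ht y x u) (P.jump_nonneg ht y u x)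
    simp only [hJ, mul_zero, zero_mul, zero_sub, neg_nonpos]
    exact mul_nonneg (by linarith) hjumps
  · obtain ⟨⟨hR, hp⟩, hR', hp'⟩ := hpos y x u hJ
    exact signed_tangent_le_sub_mul_log_div (mul_pos hR hp) (mul_pos hR' hp')
      (outSign_mem_Icc y x u) F

theorem ae_tangent_le_dissipation (hτ : 0 ≤ τ) (F : ℝ) : ∀ᵐ t ∂volume.restrict (Ioo 0 τ),
    (F + Real.sinh F) * P.outflow t - (Real.cosh F - 1) * P.activity t ≤ P.dissipation t := by
  filter_upwards [P.ae_signed_tangent_le_current_mul_force hτ F,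
    ae_restrict_mem measurableSet_Ioo] with t htangent ht
  rw [P.outflow_eq_half_sum, P.activity_eq_half_sum ht, dissipation, mul_left_comm,
    mul_left_comm _ (1 / 2 : ℝ), ← mul_sub]
  simp only [Finset.mul_sum (s := Finset.univ), ← Finset.sum_sub_distrib]
  simp only [← Finset.mul_sum]
  gcongr with y _ x _ u
  exact htangent y x u

theorem tangent_le_totalProduction (hτ : 0 < τ) (F : ℝ) :
    (F + Real.sinh F) * (∑ y, pY y - ∑ y, P.prob τ y y) -
      (Real.cosh F - 1) * (τ * P.meanActivity) ≤ P.totalProduction := by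
  have hout := (P.integrableOn_outflow hτ.le).const_mul (F + Real.sinh F)
  have hact := (P.integrableOn_activity hτ.le).const_mul (Real.cosh F - 1)
  rw [← P.integral_outflow hτ.le, ← P.integral_activity hτ, ← P.integral_dissipation hτ.le,
    ← integral_const_mul, ← integral_const_mul, ← integral_sub hout hact]
  exact integral_mono_ae (hout.sub hact) (P.integrableOn_dissipation hτ.le)
    (P.ae_tangent_le_dissipation hτ.le F)

theorem artanh_le_totalProduction (hτ : 0 < τ) {W : ℝ} (hW : 0 ≤ W)
    (hWE : W ≤ ∑ y, pY y - ∑ y, P.prob τ y y) :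
    W / (τ * P.meanActivity) ∈ Ico 0 1 ∧
      2 * W * Real.artanh (W / (τ * P.meanActivity)) ≤ P.totalProduction :=
  div_mem_Ico_and_artanh_le_of_forall_tangent_le hW hWE fun F _ =>
    P.tangent_le_totalProduction hτ F

end FeedbackProcess

/-! ### Conditional entropy -/

section Entropy

variable {ι κ : Type*} [Fintype ι] [Fintype κ]

theorem negMulLog_lt_tangent {a b : ℝ} (ha : 0 ≤ a) (hb : 0 < b) (hab : a ≠ b) :
    Real.negMulLog a < Real.negMulLog b + (-1 - Real.log b) * (a - b) := by
  rcases ha.eq_or_lt with rfl | ha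
  · have tangent_at_zero : Real.negMulLog b + (-1 - Real.log b) * (0 - b) = b := by
      rw [Real.negMulLog]; ring
    rwa [tangent_at_zero, Real.negMulLog_zero]
  · have hne : b / a ≠ 1 := fun h => hab ((div_eq_one_iff_eq ha.ne').1 h).symm
    have gap : Real.negMulLog b + (-1 - Real.log b) * (a - b) - Real.negMulLog a =
        a * ((b / a - 1) - Real.log (b / a)) := by
      rw [Real.negMulLog, Real.negMulLog, Real.log_div hb.ne' ha.ne']
      field_simp
      ring
    have gap_pos :=
      mul_pos ha (sub_pos.2 (Real.log_lt_sub_one_of_pos (div_pos hb ha) hne))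
    linarith

theorem shannon_comp_equiv (e : ι ≃ κ) (p : κ → ℝ) : shannon (fun i => p (e i)) = shannon p :=
  Equiv.sum_comp e fun k => Real.negMulLog (p k)

theorem shannon_nonneg {p : ι → ℝ} (hp : ∀ i, 0 ≤ p i) (hsum : ∑ i, p i = 1) : 0 ≤ shannon p :=
  Finset.sum_nonneg fun i _ => Real.negMulLog_nonneg (hp i)
    (hsum ▸ Finset.single_le_sum (fun j _ => hp j) (Finset.mem_univ i))

/-- The conditional entropy `H(Y|X)` of a joint distribution `p x y`. -/
def condEntropy (p : ι → κ → ℝ) : ℝ :=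
  ∑ x, (shannon (p x) - Real.negMulLog (∑ y, p x y))

theorem condEntropy_eq_sum_mul_shannon {p c : ι → κ → ℝ} {w : ι → ℝ}
    (hp : ∀ x y, p x y = w x * c x y) (hc : ∀ x, w x ≠ 0 → ∑ y, c x y = 1) :
    condEntropy p = ∑ x, w x * shannon (c x) := by
  refine Finset.sum_congr rfl fun x _ => ?_
  by_cases hx : w x = 0
  · simp [hp, hx, shannon]
  · simp only [shannon, hp, Real.negMulLog_mul, Finset.sum_add_distrib, ← Finset.sum_mul,
      ← Finset.mul_sum, hc x hx, Real.negMulLog_one, mul_zero]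
    ring

theorem eq_sum_mul_div_sum {p : ι → ℝ} (hp : ∀ i, 0 ≤ p i) (i : ι) :
    p i = (∑ j, p j) * (p i / ∑ j, p j) :=
  (mul_div_cancel_of_imp' fun h =>
    (Finset.sum_eq_zero_iff_of_nonneg fun j _ => hp j).1 h i (Finset.mem_univ i)).symm

theorem condEntropy_eq_sum_mul_shannon_div {p : ι → κ → ℝ} (hp : ∀ x y, 0 ≤ p x y) :
    condEntropy p = ∑ x, (∑ y, p x y) * shannon (fun y => p x y / ∑ z, p x z) :=
  condEntropy_eq_sum_mul_shannon (fun x => eq_sum_mul_div_sum (hp x)) fun x hx => by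
    rw [← Finset.sum_div, div_self hx]

theorem condEntropy_nonneg {p : ι → κ → ℝ} (hp : ∀ x y, 0 ≤ p x y) : 0 ≤ condEntropy p := by
  rw [condEntropy_eq_sum_mul_shannon_div hp]
  have row_nonneg (x : ι) : 0 ≤ ∑ y, p x y := Finset.sum_nonneg fun y _ => hp x y
  refine Finset.sum_nonneg fun x _ => ?_
  rcases (row_nonneg x).eq_or_lt with hx | hx
  · rw [← hx, zero_mul]
  · refine mul_nonneg hx.le (shannon_nonneg (fun y => div_nonneg (hp x y) hx.le) ?_)
    rw [← Finset.sum_div, div_self hx.ne']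

theorem condEntropy_le_shannon_sum {p : ι → κ → ℝ} (hp : ∀ x y, 0 ≤ p x y)
    (hsum : ∑ x, ∑ y, p x y = 1) : condEntropy p ≤ shannon fun y => ∑ x, p x y := by
  rw [condEntropy_eq_sum_mul_shannon_div hp]
  simp only [shannon, Finset.mul_sum]
  rw [Finset.sum_comm]
  refine Finset.sum_le_sum fun y _ => ?_
  have row_nonneg (x : ι) : 0 ≤ ∑ z, p x z := Finset.sum_nonneg fun z _ => hp x z
  have jensen := Real.concaveOn_negMulLog.le_map_sum (t := Finset.univ)
    (w := fun x => ∑ z, p x z) (p := fun x => p x y / ∑ z, p x z)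
    (fun x _ => row_nonneg x) hsum fun x _ => div_nonneg (hp x y) (row_nonneg x)
  simpa only [smul_eq_mul, ← eq_sum_mul_div_sum (hp _)] using jensen

theorem condEntropy_comp_equiv (e : ι → Equiv.Perm κ) (p : ι → κ → ℝ) :
    condEntropy (fun x y => p x (e x y)) = condEntropy p :=
  Finset.sum_congr rfl fun x _ => by
    rw [shannon_comp_equiv (e x) (p x), Equiv.sum_comp (e x) (p x)]

theorem mutualInfo_eq_sub_condEntropy {n : ℕ} (p : Fin n → Fin n → ℝ) :
    mutualInfo p = shannon (marginalY p) - condEntropy p := by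
  simp only [mutualInfo, condEntropy, shannon, marginalX, Fintype.sum_prod_type,
    Finset.sum_sub_distrib]
  ring

theorem condEntropy_initialDist {n : ℕ} (pY : Fin n → ℝ) : condEntropy (initialDist pY) = 0 := by
  simp [condEntropy, shannon, initialDist, apply_ite Real.negMulLog]

theorem mutualInfo_sub_mutualInfo_initialDist {n : ℕ} {pY : Fin n → ℝ} {q : Fin n → Fin n → ℝ}
    (hY : marginalY q = pY) : mutualInfo q - mutualInfo (initialDist pY) = -condEntropy q := by
  rw [mutualInfo_eq_sub_condEntropy, mutualInfo_eq_sub_condEntropy, condEntropy_initialDist, hY,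
    marginalY_initialDist, sub_zero, sub_sub_cancel_left]

end Entropy

namespace FeedbackProcess

variable {n : ℕ} {N : Fin n → SimpleGraph (Fin n)} {pY : Fin n → ℝ} {τ : ℝ}
  (P : FeedbackProcess N pY τ)

theorem infoChange_eq_neg_condEntropy (hτ : 0 ≤ τ) :
    P.infoChange = -condEntropy (P.prob τ) := by
  rw [infoChange, P.prob_zero,
    mutualInfo_sub_mutualInfo_initialDist (P.marginalY_prob (right_mem_Icc.2 hτ))]

theorem abs_infoChange (hτ : 0 ≤ τ) : |P.infoChange| = condEntropy (P.prob τ) := by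
  rw [P.infoChange_eq_neg_condEntropy hτ, abs_neg,
    abs_of_nonneg (condEntropy_nonneg (P.prob_nonneg τ (right_mem_Icc.2 hτ)))]

end FeedbackProcess

/-! ### Water-filling -/

theorem shannon_lt_of_log_sub_mul_nonneg {ι : Type*} [Fintype ι] {q r : ι → ℝ}
    (hq : ∀ k, 0 ≤ q k) (hr : ∀ k, 0 ≤ r k) (hsum : ∑ k, q k = ∑ k, r k)
    (hsupp : ∀ k, r k = 0 → q k = 0) (c : ℝ)
    (hslope : ∀ k, 0 < r k → 0 ≤ (Real.log (r k) - c) * (q k - r k)) (hne : q ≠ r) :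
    shannon q < shannon r := by
  have tangent_lt (k : ι) (hk : q k ≠ r k) :
      Real.negMulLog (q k) < Real.negMulLog (r k) + (-1 - c) * (q k - r k) := by
    have hrk : 0 < r k := (hr k).lt_of_ne fun h => hk ((hsupp k h.symm).trans h)
    linarith [negMulLog_lt_tangent (hq k) hrk hk, hslope k hrk]
  have tangent_le (k : ι) :
      Real.negMulLog (q k) ≤ Real.negMulLog (r k) + (-1 - c) * (q k - r k) := by
    by_cases hk : q k = r k
    · rw [hk, sub_self, mul_zero, add_zero]
    · exact (tangent_lt k hk).le
  obtain ⟨k, hk⟩ := Function.ne_iff.1 hne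
  calc shannon q < ∑ k, (Real.negMulLog (r k) + (-1 - c) * (q k - r k)) :=
        Finset.sum_lt_sum (fun k _ => tangent_le k) ⟨k, Finset.mem_univ k, tangent_lt k hk⟩
    _ = shannon r := by
        rw [Finset.sum_add_distrib, ← Finset.mul_sum, Finset.sum_sub_distrib, hsum, sub_self,
          mul_zero, add_zero, shannon]

section WaterFill

variable {n : ℕ} [NeZero n]

theorem sum_eq_zero_add_sum_Ioi (f : Fin n → ℝ) : ∑ k, f k = f 0 + ∑ k ∈ Finset.Ioi 0, f k := by
  have Ioi_zero : Finset.Ioi (0 : Fin n) = Finset.univ.erase 0 := by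
    ext k; simp [Fin.pos_iff_ne_zero]
  rw [Ioi_zero, Finset.add_sum_erase _ _ (Finset.mem_univ _)]

/-- The mass left outside the state `0` when `d` is cut off at the level `θ`. -/
def fillMass (d : Fin n → ℝ) (θ : ℝ) : ℝ := ∑ k ∈ Finset.Ioi (0 : Fin n), min θ (d k)

/-- The water-filling distribution: `d` cut off at the level `θ`, with the surplus moved to the
state `0`.  For `fillMass d θ = E` it is the distribution `p̃_E` of the Fano inequality. -/
def waterFill (d : Fin n → ℝ) (θ : ℝ) (k : Fin n) : ℝ :=
  if k = 0 then 1 - fillMass d θ else min θ (d k)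

/-- A probability vector in descending order. -/
structure IsDescending (d : Fin n → ℝ) : Prop where
  nonneg : ∀ k, 0 ≤ d k
  sum_eq : ∑ k, d k = 1
  anti : Antitone d

variable {d : Fin n → ℝ} {θ θ' : ℝ}

theorem waterFill_zero (d : Fin n → ℝ) (θ : ℝ) : waterFill d θ 0 = 1 - fillMass d θ := if_pos rfl

theorem waterFill_of_ne {k : Fin n} (hk : k ≠ 0) : waterFill d θ k = min θ (d k) := if_neg hk

theorem fillMass_mono (d : Fin n → ℝ) : Monotone (fillMass d) := fun _ _ h =>
  Finset.sum_le_sum fun _ _ => min_le_min_right _ h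

theorem continuous_fillMass (d : Fin n → ℝ) : Continuous (fillMass d) := by
  unfold fillMass; fun_prop

theorem continuous_shannon_waterFill (d : Fin n → ℝ) :
    Continuous fun θ => shannon (waterFill d θ) := by
  refine continuous_finsetSum _ fun k _ => Real.continuous_negMulLog.comp ?_
  have := continuous_fillMass d
  unfold waterFill
  split_ifs <;> fun_prop

theorem sum_waterFill (d : Fin n → ℝ) (θ : ℝ) : ∑ k, waterFill d θ k = 1 := by
  have sum_Ioi : ∑ k ∈ Finset.Ioi (0 : Fin n), waterFill d θ k = fillMass d θ :=
    Finset.sum_congr rfl fun k hk => waterFill_of_ne (Finset.mem_Ioi.1 hk).ne'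
  rw [sum_eq_zero_add_sum_Ioi, sum_Ioi, waterFill_zero, sub_add_cancel]

theorem eq_single_of_one_le {q : Fin n → ℝ} (hq : ∀ k, 0 ≤ q k) (hqs : ∑ k, q k = 1)
    (hq0 : 1 ≤ q 0) : q = Pi.single 0 1 := by
  have split := sum_eq_zero_add_sum_Ioi q
  have rest_nonneg : 0 ≤ ∑ k ∈ Finset.Ioi (0 : Fin n), q k := Finset.sum_nonneg fun k _ => hq k
  have rest_zero : ∀ k ∈ Finset.Ioi (0 : Fin n), q k = 0 :=
    (Finset.sum_eq_zero_iff_of_nonneg fun k _ => hq k).1 (by linarith)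
  ext k
  by_cases hk : k = 0
  · rw [hk, Pi.single_eq_same]
    linarith
  · rw [Pi.single_eq_of_ne hk, rest_zero k (Finset.mem_Ioi.2 (Fin.pos_iff_ne_zero.2 hk))]

namespace IsDescending

theorem sum_Ioi (hd : IsDescending d) : ∑ k ∈ Finset.Ioi (0 : Fin n), d k = 1 - d 0 := by
  rw [← hd.sum_eq, sum_eq_zero_add_sum_Ioi, add_sub_cancel_left]

variable (hd : IsDescending d)

include hd

theorem fillMass_zero : fillMass d 0 = 0 :=
  Finset.sum_eq_zero fun k _ => min_eq_left (hd.nonneg k)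

theorem fillMass_top : fillMass d (d 0) = 1 - d 0 := by
  rw [← hd.sum_Ioi]
  exact Finset.sum_congr rfl fun k _ => min_eq_right (hd.anti (Fin.zero_le k))

theorem fillMass_le (θ : ℝ) : fillMass d θ ≤ 1 - d 0 := by
  rw [← hd.sum_Ioi]
  exact Finset.sum_le_sum fun k _ => min_le_right _ _

theorem fillMass_mem (hθ : 0 ≤ θ) : fillMass d θ ∈ Icc 0 (1 - d 0) :=
  ⟨hd.fillMass_zero.symm.le.trans (fillMass_mono d hθ), hd.fillMass_le θ⟩

theorem exists_fillMass_eq {W : ℝ} (hW : W ∈ Icc 0 (1 - d 0)) :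
    ∃ θ ∈ Icc 0 (d 0), fillMass d θ = W := by
  have ivt := intermediate_value_Icc (hd.nonneg 0) (continuous_fillMass d).continuousOn
  rw [hd.fillMass_zero, hd.fillMass_top] at ivt
  exact ivt hW

theorem waterFill_top : waterFill d (d 0) = d := by
  ext k
  by_cases hk : k = 0
  · rw [hk, waterFill_zero, hd.fillMass_top, sub_sub_cancel]
  · rw [waterFill_of_ne hk, min_eq_right (hd.anti (Fin.zero_le k))]

theorem waterFill_zero_level : waterFill d 0 = Pi.single 0 1 := by
  ext k
  by_cases hk : k = 0
  · rw [hk, waterFill_zero, hd.fillMass_zero, sub_zero, Pi.single_eq_same]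
  · rw [waterFill_of_ne hk, min_eq_left (hd.nonneg k), Pi.single_eq_of_ne hk]

theorem shannon_waterFill_zero : shannon (waterFill d 0) = 0 := by
  rw [hd.waterFill_zero_level]
  simp [shannon, Pi.single_apply, apply_ite Real.negMulLog]

theorem waterFill_nonneg (hθ : 0 ≤ θ) (k : Fin n) : 0 ≤ waterFill d θ k := by
  by_cases hk : k = 0
  · rw [hk, waterFill_zero]
    linarith [hd.fillMass_le θ, hd.nonneg 0]
  · exact (waterFill_of_ne hk).symm ▸ le_min hθ (hd.nonneg k)

theorem log_waterFill_sub_mul_nonneg (hθ : 0 < θ) (hθ' : θ ≤ d 0) {q : Fin n → ℝ}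
    (hq0 : 1 - fillMass d θ ≤ q 0) (hqd : ∀ k, k ≠ 0 → q k ≤ d k) (k : Fin n)
    (hk : 0 < waterFill d θ k) :
    0 ≤ (Real.log (waterFill d θ k) - Real.log θ) * (q k - waterFill d θ k) := by
  rcases eq_or_ne k 0 with rfl | hk0
  · rw [waterFill_zero]
    exact mul_nonneg (sub_nonneg.2 (Real.log_le_log hθ (by linarith [hd.fillMass_le θ])))
      (sub_nonneg.2 hq0)
  · rw [waterFill_of_ne hk0] at hk ⊢
    rcases le_total θ (d k) with h | h
    · rw [min_eq_left h, sub_self, zero_mul]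
    · rw [min_eq_right h] at hk ⊢
      exact mul_nonneg_of_nonpos_of_nonpos (sub_nonpos.2 (Real.log_le_log hk h))
        (sub_nonpos.2 (hqd k hk0))

theorem shannon_lt_shannon_waterFill (hθ : θ ∈ Icc 0 (d 0)) {q : Fin n → ℝ}
    (hq : ∀ k, 0 ≤ q k) (hqs : ∑ k, q k = 1) (hq0 : 1 - fillMass d θ ≤ q 0)
    (hqd : ∀ k, k ≠ 0 → q k ≤ d k) (hne : q ≠ waterFill d θ) :
    shannon q < shannon (waterFill d θ) := by
  rcases hθ.1.eq_or_lt with rfl | hθ0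
  · refine absurd ?_ hne
    rw [hd.fillMass_zero, sub_zero] at hq0
    rw [hd.waterFill_zero_level, eq_single_of_one_le hq hqs hq0]
  refine shannon_lt_of_log_sub_mul_nonneg hq (hd.waterFill_nonneg hθ.1)
    (hqs.trans (sum_waterFill d θ).symm) (fun k hk => ?_) (Real.log θ)
    (hd.log_waterFill_sub_mul_nonneg hθ0 hθ.2 hq0 hqd) hne
  have hk0 : k ≠ 0 := by
    rintro rfl
    rw [waterFill_zero] at hk
    linarith [hd.fillMass_le θ, hθ.2]
  rw [waterFill_of_ne hk0] at hk
  rcases min_choice θ (d k) with h | h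
  · exact absurd (h.symm.trans hk) hθ0.ne'
  · exact le_antisymm ((hqd k hk0).trans (h.symm.trans hk).le) (hq k)

theorem shannon_le_shannon_waterFill (hθ : θ ∈ Icc 0 (d 0)) {q : Fin n → ℝ}
    (hq : ∀ k, 0 ≤ q k) (hqs : ∑ k, q k = 1) (hq0 : 1 - fillMass d θ ≤ q 0)
    (hqd : ∀ k, k ≠ 0 → q k ≤ d k) : shannon q ≤ shannon (waterFill d θ) := by
  rcases eq_or_ne q (waterFill d θ) with rfl | hne
  · exact le_rfl
  · exact (hd.shannon_lt_shannon_waterFill hθ hq hqs hq0 hqd hne).le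

theorem shannon_waterFill_lt (hθ : 0 ≤ θ) (hθ' : θ' ∈ Icc 0 (d 0))
    (h : fillMass d θ < fillMass d θ') :
    shannon (waterFill d θ) < shannon (waterFill d θ') := by
  refine hd.shannon_lt_shannon_waterFill hθ' (hd.waterFill_nonneg hθ) (sum_waterFill d θ)
    ?_ ?_ ?_
  · rw [waterFill_zero]
    linarith
  · exact fun k hk => (waterFill_of_ne hk).trans_le (min_le_right _ _)
  · intro heq
    have := congrFun heq 0
    rw [waterFill_zero, waterFill_zero] at this
    linarith

theorem shannon_waterFill_mem (hθ : 0 ≤ θ) : shannon (waterFill d θ) ∈ Icc 0 (shannon d) := by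
  refine ⟨shannon_nonneg (hd.waterFill_nonneg hθ) (sum_waterFill d θ), ?_⟩
  have maximal := hd.shannon_le_shannon_waterFill ⟨hd.nonneg 0, le_rfl⟩
    (hd.waterFill_nonneg hθ) (sum_waterFill d θ)
    (by rw [waterFill_zero, hd.fillMass_top]; linarith [hd.fillMass_le θ])
    fun k hk => (waterFill_of_ne hk).trans_le (min_le_right _ _)
  rwa [hd.waterFill_top] at maximal

theorem exists_shannon_waterFill_eq {I : ℝ} (hI : I ∈ Icc 0 (shannon d)) :
    ∃ θ ∈ Icc 0 (d 0), shannon (waterFill d θ) = I := by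
  have ivt := intermediate_value_Icc (hd.nonneg 0) (continuous_shannon_waterFill d).continuousOn
  rw [hd.shannon_waterFill_zero, hd.waterFill_top] at ivt
  exact ivt hI

end IsDescending

end WaterFill

/-! ### Fano's inequality -/

section Fano

variable {n : ℕ} {p : Fin n → ℝ}

theorem isDescending_sortDesc (hpos : ∀ y, 0 ≤ p y) (hsum : ∑ y, p y = 1) :
    IsDescending (sortDesc p) where
  nonneg _ := hpos _
  sum_eq := (Equiv.sum_comp (Tuple.sort fun i => -p i) p).trans hsum
  anti _ _ h := neg_le_neg_iff.1 (Tuple.monotone_sort (fun i => -p i) h)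

theorem shannon_sortDesc (p : Fin n → ℝ) : shannon (sortDesc p) = shannon p :=
  shannon_comp_equiv (Tuple.sort fun i => -p i) p

theorem sortDesc_apply_of_antitone {σ : Equiv.Perm (Fin n)}
    (hσ : Antitone fun k => p (σ.symm k)) (y : Fin n) : sortDesc p (σ y) = p y := by
  have neg_sorted : Monotone ((fun i => -p i) ∘ σ.symm) := fun _ _ h => neg_le_neg (hσ h)
  have := congrFun (Tuple.comp_sort_eq_comp_iff_monotone.2 neg_sorted) (σ y)
  simp only [Function.comp_apply, Equiv.symm_apply_apply] at this
  exact (neg_injective this).symm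

theorem sum_ite_lt (f : Fin n → ℝ) (k : Fin n) :
    (∑ j, if k < j then f j else 0) = ∑ j ∈ Finset.Ioi k, f j := by
  rw [← Finset.sum_filter, Finset.filter_lt_eq_Ioi]

theorem condEntropy_le_shannon_of_marginalY_eq {q : Fin n → Fin n → ℝ} (hq : ∀ x y, 0 ≤ q x y)
    (hsum : ∑ y, p y = 1) (hY : marginalY q = p) : condEntropy q ≤ shannon p := by
  subst hY
  exact condEntropy_le_shannon_sum hq (Finset.sum_comm.trans hsum)

section RowSwap

variable {ι : Type*} [DecidableEq ι]

/-- The permutation of row `x` of `q` that brings the larger of the entries in the columns `x` and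
`y₀` to column `y₀`, so that the maximal error-free mass is collected in a single column. -/
def rowSwap (q : ι → ι → ℝ) (y₀ x : ι) : Equiv.Perm ι :=
  Equiv.swap (if q x y₀ ≤ q x x then x else y₀) y₀

theorem apply_rowSwap_self (q : ι → ι → ℝ) (y₀ x : ι) :
    q x (rowSwap q y₀ x y₀) = max (q x y₀) (q x x) := by
  rw [rowSwap, Equiv.swap_apply_right, max_def]
  split_ifs <;> rfl

theorem apply_rowSwap_le (q : ι → ι → ℝ) {y₀ y : ι} (hy : y ≠ y₀) (x : ι) :
    q x (rowSwap q y₀ x y) ≤ q x y := by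
  rw [rowSwap]
  split_ifs with h
  · rcases eq_or_ne y x with rfl | hyx
    · rwa [Equiv.swap_apply_left]
    · rw [Equiv.swap_apply_of_ne_of_ne hyx hy]
  · rw [Equiv.swap_self, Equiv.refl_apply]

end RowSwap

variable [NeZero n]

theorem exists_condEntropy_le_shannon {q : Fin n → Fin n → ℝ} (hq : ∀ x y, 0 ≤ q x y)
    (hsum : ∑ x, ∑ y, q x y = 1) (hY : marginalY q = p) :
    ∃ r : Fin n → ℝ, (∀ k, 0 ≤ r k) ∧ ∑ k, r k = 1 ∧ condEntropy q ≤ shannon r ∧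
      ∑ y, q y y ≤ r 0 ∧ ∀ k, k ≠ 0 → r k ≤ sortDesc p k := by
  subst hY
  set s := Tuple.sort fun i => -marginalY q i
  let q' : Fin n → Fin n → ℝ := fun x k => q x (rowSwap q (s 0) x (s k))
  have sum_row (x : Fin n) : ∑ k, q' x k = ∑ y, q x y :=
    Equiv.sum_comp (s.trans (rowSwap q (s 0) x)) (q x)
  have sum_q' : ∑ x, ∑ k, q' x k = 1 := by simp only [sum_row, hsum]
  have q'_zero (x : Fin n) : q' x 0 = max (q x (s 0)) (q x x) := apply_rowSwap_self q (s 0) x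
  refine ⟨fun k => ∑ x, q' x k, fun k => Finset.sum_nonneg fun x _ => hq _ _,
    Finset.sum_comm.trans sum_q', ?_, ?_, fun k hk => ?_⟩
  · rw [← condEntropy_comp_equiv (fun x => s.trans (rowSwap q (s 0) x)) q]
    exact condEntropy_le_shannon_sum (p := q') (fun x k => hq _ _) sum_q'
  · exact Finset.sum_le_sum fun x _ => (le_max_right _ _).trans_eq (q'_zero x).symm
  · exact Finset.sum_le_sum fun x _ => apply_rowSwap_le q (s.injective.ne hk) x

theorem sum_Ioi_zero_eq_sum_Ioc_add_sum_Ioi (f : Fin n → ℝ) (k : Fin n) :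
    ∑ j ∈ Finset.Ioi (0 : Fin n), f j =
      ∑ j ∈ Finset.Ioc 0 k, f j + ∑ j ∈ Finset.Ioi k, f j := by
  rw [← Finset.sum_union (Finset.disjoint_left.2 fun j hj hj' =>
    (Finset.mem_Ioc.1 hj).2.not_gt (Finset.mem_Ioi.1 hj'))]
  congr 1
  ext j
  simp only [Finset.mem_Ioi, Finset.mem_union, Finset.mem_Ioc]
  have := Fin.zero_le k
  grind

theorem sum_Ioc_zero_const (k : Fin n) (c : ℝ) : ∑ _j ∈ Finset.Ioc 0 k, c = k.val * c := by simp

theorem fill_condition_iff {d : Fin n → ℝ} (hd : Antitone d) (θ : ℝ) {k : Fin n} (hk : 0 < k.val) :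
    (fillMass d θ - ∑ j, if k < j then d j else 0) / (k.val : ℝ) < d k ↔ θ < d k := by
  have hk' : (0 : ℝ) < k.val := by exact_mod_cast hk
  rw [sum_ite_lt, fillMass, sum_Ioi_zero_eq_sum_Ioc_add_sum_Ioi _ k, div_lt_iff₀ hk']
  constructor
  · intro h
    by_contra! hle
    have head_ge : k.val * d k ≤ ∑ j ∈ Finset.Ioc 0 k, min θ (d j) := by
      rw [← sum_Ioc_zero_const]
      exact Finset.sum_le_sum fun j hj => le_min hle (hd (Finset.mem_Ioc.1 hj).2)
    have tail_eq : ∑ j ∈ Finset.Ioi k, min θ (d j) = ∑ j ∈ Finset.Ioi k, d j :=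
      Finset.sum_congr rfl fun j hj =>
        min_eq_right ((hd (Finset.mem_Ioi.1 hj).le).trans hle)
    linarith
  · intro h
    have head_le : ∑ j ∈ Finset.Ioc 0 k, min θ (d j) ≤ k.val * θ := by
      rw [← sum_Ioc_zero_const]
      exact Finset.sum_le_sum fun j _ => min_le_left _ _
    have tail_le : ∑ j ∈ Finset.Ioi k, min θ (d j) ≤ ∑ j ∈ Finset.Ioi k, d j :=
      Finset.sum_le_sum fun j _ => min_le_right _ _
    linarith [mul_lt_mul_of_pos_left h hk']

section SortDesc

variable (hd : IsDescending (sortDesc p)) {θ : ℝ}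

include hd

theorem succ_le_cutoff_iff {k : Fin n} (hk : k ≠ 0) :
    k.val + 1 ≤ cutoff p (fillMass (sortDesc p) θ) ↔ θ < sortDesc p k := by
  rw [cutoff, Finset.le_sup_iff (Nat.succ_pos _)]
  simp only [Finset.mem_filter, Finset.mem_univ, true_and]
  constructor
  · rintro ⟨j, ⟨hj, hlt⟩, hle⟩
    exact ((fill_condition_iff hd.anti θ hj).1 hlt).trans_le (hd.anti (Nat.le_of_succ_le_succ hle))
  · intro h
    have hk0 : 0 < k.val := Fin.pos_iff_ne_zero.2 hk
    exact ⟨k, ⟨hk0, (fill_condition_iff hd.anti θ hk0).2 h⟩, le_rfl⟩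

theorem exists_cutoff_eq (hlt : fillMass (sortDesc p) θ < 1 - sortDesc p 0) :
    ∃ m : Fin n, m ≠ 0 ∧ θ < sortDesc p m ∧
      cutoff p (fillMass (sortDesc p) θ) = m.val + 1 := by
  obtain ⟨k, hk, hkθ⟩ : ∃ k : Fin n, k ≠ 0 ∧ θ < sortDesc p k := by
    by_contra! h
    refine hlt.ne ?_
    rw [← hd.sum_Ioi]
    exact Finset.sum_congr rfl fun k hk => min_eq_right (h k (Finset.mem_Ioi.1 hk).ne')
  have k_lt_cutoff := (succ_le_cutoff_iff hd hk).2 hkθ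
  have cutoff_le : cutoff p (fillMass (sortDesc p) θ) ≤ n := Finset.sup_le fun j _ => j.isLt
  have k_pos : 0 < k.val := Fin.pos_iff_ne_zero.2 hk
  obtain ⟨m, hm⟩ : ∃ m : Fin n, cutoff p (fillMass (sortDesc p) θ) = m.val + 1 :=
    ⟨⟨cutoff p (fillMass (sortDesc p) θ) - 1, by omega⟩, by simp only; omega⟩
  have m_ne_zero : m ≠ 0 := Fin.pos_iff_ne_zero.1 (Fin.lt_def.2 (by rw [Fin.val_zero]; omega))
  exact ⟨m, m_ne_zero, (succ_le_cutoff_iff hd m_ne_zero).1 hm.ge, hm⟩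

theorem level_eq (hlt : fillMass (sortDesc p) θ < 1 - sortDesc p 0) :
    (fillMass (sortDesc p) θ - ∑ j : Fin n, if cutoff p (fillMass (sortDesc p) θ) < j.val + 1
      then sortDesc p j else 0) / ((cutoff p (fillMass (sortDesc p) θ) : ℝ) - 1) = θ := by
  obtain ⟨m, hm0, hmθ, hcutoff⟩ := exists_cutoff_eq hd hlt
  have m_pos : (0 : ℝ) < m.val := by exact_mod_cast Fin.pos_iff_ne_zero.2 hm0
  have head_eq : ∑ j ∈ Finset.Ioc 0 m, min θ (sortDesc p j) = m.val * θ := by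
    rw [← sum_Ioc_zero_const]
    exact Finset.sum_congr rfl fun j hj =>
      min_eq_left (hmθ.le.trans (hd.anti (Finset.mem_Ioc.1 hj).2))
  have tail_eq : ∑ j ∈ Finset.Ioi m, min θ (sortDesc p j) = ∑ j ∈ Finset.Ioi m, sortDesc p j := by
    refine Finset.sum_congr rfl fun j hj => min_eq_right (le_of_not_gt fun hlt => ?_)
    have m_lt_j := Finset.mem_Ioi.1 hj
    have := (succ_le_cutoff_iff hd ((Fin.zero_le m).trans_lt m_lt_j).ne').2 hlt
    rw [hcutoff] at this
    exact absurd m_lt_j (not_lt.2 (Nat.le_of_succ_le_succ this))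
  rw [hcutoff]
  simp only [add_lt_add_iff_right, Fin.val_fin_lt]
  rw [sum_ite_lt, fillMass, sum_Ioi_zero_eq_sum_Ioc_add_sum_Ioi _ m, head_eq, tail_eq,
    Nat.cast_succ, add_sub_cancel_right, add_sub_cancel_right, mul_div_cancel_left₀ _ m_pos.ne']

theorem fanoDist_fillMass (θ : ℝ) :
    fanoDist p (fillMass (sortDesc p) θ) = waterFill (sortDesc p) θ := by
  rcases (hd.fillMass_le θ).eq_or_lt with htop | hlt
  · have cut_eq (k : Fin n) (hk : k ≠ 0) : min θ (sortDesc p k) = sortDesc p k := by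
      rw [← hd.sum_Ioi] at htop
      exact (Finset.sum_eq_sum_iff_of_le fun k _ => min_le_right _ _).1 htop k
        (Finset.mem_Ioi.2 (Fin.pos_iff_ne_zero.2 hk))
    ext k
    rw [fanoDist, if_pos (by linarith)]
    rcases eq_or_ne k 0 with rfl | hk
    · rw [waterFill_zero, htop, sub_sub_cancel]
    · rw [waterFill_of_ne hk, cut_eq k hk]
  · ext k
    rw [fanoDist, if_neg (by linarith), level_eq hd hlt]
    rcases eq_or_ne k 0 with rfl | hk
    · rw [if_pos rfl, waterFill_zero]
    · rw [if_neg hk, waterFill_of_ne hk]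
      split_ifs with h
      · exact (min_eq_left ((succ_le_cutoff_iff hd hk).1 h).le).symm
      · exact (min_eq_right (le_of_not_gt fun h' => h ((succ_le_cutoff_iff hd hk).2 h'))).symm

theorem bijOn_shannon_fanoDist :
    BijOn (fun W => shannon (fanoDist p W)) (Icc 0 (1 - sortDesc p 0)) (Icc 0 (shannon p)) := by
  refine ⟨fun W hW => ?_, StrictMonoOn.injOn fun W hW W' hW' hlt => ?_, fun I hI => ?_⟩
  · obtain ⟨θ, hθ, rfl⟩ := hd.exists_fillMass_eq hW
    simp only [fanoDist_fillMass hd]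
    rw [← shannon_sortDesc p]
    exact hd.shannon_waterFill_mem hθ.1
  · obtain ⟨θ, hθ, rfl⟩ := hd.exists_fillMass_eq hW
    obtain ⟨θ', hθ', rfl⟩ := hd.exists_fillMass_eq hW'
    simp only [fanoDist_fillMass hd]
    exact hd.shannon_waterFill_lt hθ.1 hθ' hlt
  · rw [← shannon_sortDesc p] at hI
    obtain ⟨θ, hθ, rfl⟩ := hd.exists_shannon_waterFill_eq hI
    exact ⟨_, hd.fillMass_mem hθ.1, by simp only [fanoDist_fillMass hd]⟩

variable {I : ℝ} (hI : I ∈ Icc 0 (shannon p))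

include hI

theorem minWasserstein_mem : minWasserstein p I ∈ Icc 0 (1 - sortDesc p 0) :=
  (bijOn_shannon_fanoDist hd).surjOn.mapsTo_invFunOn hI

theorem shannon_fanoDist_minWasserstein : shannon (fanoDist p (minWasserstein p I)) = I :=
  (bijOn_shannon_fanoDist hd).surjOn.rightInvOn_invFunOn hI

theorem minWasserstein_eq_zero_iff : minWasserstein p I = 0 ↔ I = 0 := by
  have shannon_zero : shannon (fanoDist p 0) = 0 := by
    have fanoDist_zero := fanoDist_fillMass hd 0
    rw [hd.fillMass_zero] at fanoDist_zero
    rw [fanoDist_zero, hd.shannon_waterFill_zero]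
  have mem := minWasserstein_mem hd hI
  rw [← (bijOn_shannon_fanoDist hd).injOn.eq_iff mem (left_mem_Icc.2 (mem.1.trans mem.2))]
  simp only [shannon_zero, shannon_fanoDist_minWasserstein hd hI]

end SortDesc

/-- The sharp form of Fano's inequality. -/
theorem minWasserstein_condEntropy_le {q : Fin n → Fin n → ℝ} (hq : ∀ x y, 0 ≤ q x y)
    (hpos : ∀ y, 0 ≤ p y) (hsum : ∑ y, p y = 1) (hY : marginalY q = p) :
    minWasserstein p (condEntropy q) ≤ 1 - ∑ y, q y y := by
  have hd := isDescending_sortDesc hpos hsum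
  have hsum_q : ∑ x, ∑ y, q x y = 1 := by
    rw [Finset.sum_comm, ← hsum, ← hY]
    rfl
  have hI : condEntropy q ∈ Icc 0 (shannon p) :=
    ⟨condEntropy_nonneg hq, condEntropy_le_shannon_of_marginalY_eq hq hsum hY⟩
  obtain ⟨r, hr, hr_sum, entropy_le, diag_le, r_le⟩ :=
    exists_condEntropy_le_shannon hq hsum_q hY
  obtain ⟨θ, hθ, hW⟩ := hd.exists_fillMass_eq (minWasserstein_mem hd hI)
  have entropy_eq : shannon (waterFill (sortDesc p) θ) = condEntropy q := by
    rw [← fanoDist_fillMass hd, hW, shannon_fanoDist_minWasserstein hd hI]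
  by_contra! hlt
  rw [← hW] at hlt
  have r_ne : r ≠ waterFill (sortDesc p) θ := by
    rintro rfl
    rw [waterFill_zero] at diag_le
    linarith
  exact (hd.shannon_lt_shannon_waterFill hθ hr hr_sum (by linarith) r_le r_ne).not_ge
    (entropy_eq.trans_le entropy_le)

end Fano

namespace FeedbackProcess

variable {n : ℕ} {N : Fin n → SimpleGraph (Fin n)} {pY : Fin n → ℝ} {τ : ℝ}
  (P : FeedbackProcess N pY τ)

theorem abs_infoChange_mem (hτ : 0 ≤ τ) (hsum : ∑ y, pY y = 1) :
    |P.infoChange| ∈ Icc 0 (shannon pY) := by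
  refine ⟨abs_nonneg _, (P.abs_infoChange hτ).trans_le ?_⟩
  exact condEntropy_le_shannon_of_marginalY_eq (P.prob_nonneg τ (right_mem_Icc.2 hτ)) hsum
    (P.marginalY_prob (right_mem_Icc.2 hτ))

theorem entropyProduction_eq_sub_abs (hτ : 0 ≤ τ) {β : ℝ} (hβ : β ≠ 0) :
    P.entropyProduction β = P.totalProduction - |P.infoChange| := by
  rw [P.entropyProduction_eq hτ hβ, P.abs_infoChange hτ, P.infoChange_eq_neg_condEntropy hτ,
    sub_eq_add_neg]

theorem speed_limit [NeZero n] (hpos : ∀ y, 0 ≤ pY y) (hsum : ∑ y, pY y = 1) (hτ : 0 < τ) {β : ℝ}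
    (hβ : β ≠ 0) :
    minWasserstein pY |P.infoChange| / (τ * P.meanActivity) ∈ Ico 0 1 ∧
      activityBound pY τ P.meanActivity |P.infoChange| ≤ P.entropyProduction β := by
  have hτ_mem : τ ∈ Icc 0 τ := right_mem_Icc.2 hτ.le
  have minWasserstein_nonneg : 0 ≤ minWasserstein pY |P.infoChange| :=
    (minWasserstein_mem (isDescending_sortDesc hpos hsum) (P.abs_infoChange_mem hτ.le hsum)).1
  have minWasserstein_le :
      minWasserstein pY |P.infoChange| ≤ ∑ y, pY y - ∑ y, P.prob τ y y := by
    rw [P.abs_infoChange hτ.le, hsum]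
    exact minWasserstein_condEntropy_le (P.prob_nonneg τ hτ_mem) hpos hsum
      (P.marginalY_prob hτ_mem)
  obtain ⟨ratio_mem, artanh_le⟩ :=
    P.artanh_le_totalProduction hτ minWasserstein_nonneg minWasserstein_le
  refine ⟨ratio_mem, ?_⟩
  rw [activityBound, P.entropyProduction_eq_sub_abs hτ.le hβ]
  linarith

end FeedbackProcess

/-! ### The optimal final distribution -/

section OptimalFinal

variable {n : ℕ} [NeZero n] {p : Fin n → ℝ} {σ : Equiv.Perm (Fin n)} {W θ : ℝ}

section FanoDist

variable (hd : IsDescending (sortDesc p)) (hW : W ∈ Icc 0 (1 - sortDesc p 0))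

include hd hW

theorem fanoDist_zero : fanoDist p W 0 = 1 - W := by
  obtain ⟨θ, -, rfl⟩ := hd.exists_fillMass_eq hW
  rw [fanoDist_fillMass hd, waterFill_zero]

theorem fanoDist_nonneg (k : Fin n) : 0 ≤ fanoDist p W k := by
  obtain ⟨θ, hθ, rfl⟩ := hd.exists_fillMass_eq hW
  rw [fanoDist_fillMass hd]
  exact hd.waterFill_nonneg hθ.1 k

theorem sum_fanoDist : ∑ k, fanoDist p W k = 1 := by
  obtain ⟨θ, -, rfl⟩ := hd.exists_fillMass_eq hW
  rw [fanoDist_fillMass hd, sum_waterFill]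

end FanoDist

theorem optimalCond_eq_fanoDist_swap (x y : Fin n) :
    optimalCond p σ W x y = fanoDist p W (σ.trans (Equiv.swap (σ x) 0) y) := by
  rw [optimalCond, Equiv.trans_apply]
  split_ifs with hyx hy
  · rw [hyx, Equiv.swap_apply_left]
  · rw [hy, Equiv.swap_apply_right]
  · rw [Equiv.swap_apply_of_ne_of_ne (σ.injective.ne hyx) hy]

theorem sum_optimalCond (x : Fin n) : ∑ y, optimalCond p σ W x y = ∑ k, fanoDist p W k := by
  simp only [optimalCond_eq_fanoDist_swap]
  exact Equiv.sum_comp _ (fanoDist p W)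

theorem shannon_optimalCond (x : Fin n) :
    shannon (optimalCond p σ W x) = shannon (fanoDist p W) := by
  rw [funext (optimalCond_eq_fanoDist_swap x)]
  exact shannon_comp_equiv _ (fanoDist p W)

theorem optimalX_eq_ite (hW : 1 - W ≤ sortDesc p 0) (x : Fin n) :
    optimalX p σ W x = if x = σ.symm 0 then 1 else 0 := by
  rw [optimalX, if_pos hW]
  simp only [Equiv.eq_symm_apply]

section Level

variable (hd : IsDescending (sortDesc p)) (hσ : Antitone fun k => p (σ.symm k))

include hd hσ

omit hd in
theorem sum_min_eq (hθ : θ ≤ sortDesc p 0) :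
    ∑ y, min θ (p y) = fillMass (sortDesc p) θ + θ := by
  calc ∑ y, min θ (p y) = ∑ y, min θ (sortDesc p (σ y)) := by
        simp only [sortDesc_apply_of_antitone hσ]
    _ = ∑ k, min θ (sortDesc p k) := Equiv.sum_comp σ fun k => min θ (sortDesc p k)
    _ = fillMass (sortDesc p) θ + θ := by
        rw [sum_eq_zero_add_sum_Ioi, min_eq_left hθ, fillMass, add_comm]

variable (hlt : fillMass (sortDesc p) θ < 1 - sortDesc p 0)

include hlt

omit hσ in
theorem lt_sortDesc_zero : θ < sortDesc p 0 := by
  obtain ⟨m, -, hm, -⟩ := exists_cutoff_eq hd hlt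
  exact hm.trans_le (hd.anti (Fin.zero_le m))

omit hσ in
theorem fanoDist_one : fanoDist p (fillMass (sortDesc p) θ) 1 = θ := by
  obtain ⟨m, hm0, hmθ, -⟩ := exists_cutoff_eq hd hlt
  have m_pos : 0 < m.val := Fin.pos_iff_ne_zero.2 hm0
  have val_one : (1 : Fin n).val = 1 := by rw [Fin.val_one', Nat.mod_eq_of_lt (by omega)]
  have one_ne_zero : (1 : Fin n) ≠ 0 := Fin.val_ne_zero_iff.1 (val_one ▸ Nat.one_ne_zero)
  have one_le : (1 : Fin n) ≤ m := Fin.le_def.2 (by omega)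
  rw [fanoDist_fillMass hd, waterFill_of_ne one_ne_zero,
    min_eq_left (hmθ.le.trans (hd.anti one_le))]

theorem succ_le_cutoff_iff_lt (x : Fin n) :
    (σ x).val + 1 ≤ cutoff p (fillMass (sortDesc p) θ) ↔ θ < p x := by
  rw [← sortDesc_apply_of_antitone hσ x]
  rcases eq_or_ne (σ x) 0 with hx | hx
  · obtain ⟨m, -, -, hm⟩ := exists_cutoff_eq hd hlt
    simp [hx, hm, lt_sortDesc_zero hd hlt]
  · exact succ_le_cutoff_iff hd hx

theorem optimalX_eq_max_div (x : Fin n) :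
    optimalX p σ (fillMass (sortDesc p) θ) x =
      max (p x - θ) 0 / (1 - fillMass (sortDesc p) θ - θ) := by
  rw [optimalX, if_neg (by linarith), fanoDist_one hd hlt, fanoDist_fillMass hd, waterFill_zero,
    if_congr (succ_le_cutoff_iff_lt hd hσ hlt x) rfl rfl]
  split_ifs with h
  · rw [max_eq_left (by linarith)]
  · rw [max_eq_right (by linarith), zero_div]

theorem sum_optimalX_of_lt (hsum : ∑ y, p y = 1) :
    ∑ x, optimalX p σ (fillMass (sortDesc p) θ) x = 1 := by
  have hθ := lt_sortDesc_zero hd hlt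
  have excess (x : Fin n) : max (p x - θ) 0 = p x - min θ (p x) := by
    rcases le_total θ (p x) with h | h
    · rw [max_eq_left (sub_nonneg.2 h), min_eq_left h]
    · rw [max_eq_right (sub_nonpos.2 h), min_eq_right h, sub_self]
  simp only [optimalX_eq_max_div hd hσ hlt, ← Finset.sum_div, excess, Finset.sum_sub_distrib,
    hsum, sum_min_eq hσ hθ.le]
  rw [← sub_sub, div_self (by linarith)]

theorem optimalX_eq_zero_of_lt {x : Fin n} (hx : p x < θ) :
    optimalX p σ (fillMass (sortDesc p) θ) x = 0 := by
  rw [optimalX_eq_max_div hd hσ hlt, max_eq_right (by linarith), zero_div]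

theorem optimalFinal_of_ne {x y : Fin n} (hyx : y ≠ x) :
    optimalFinal p σ (fillMass (sortDesc p) θ) x y =
      optimalX p σ (fillMass (sortDesc p) θ) x * min θ (p y) := by
  rw [optimalFinal]
  rcases lt_or_ge (p x) θ with hx | hx
  · simp only [optimalX_eq_zero_of_lt hd hσ hlt hx, zero_mul]
  rw [optimalCond, if_neg hyx, fanoDist_fillMass hd]
  split_ifs with hy
  · have hσx : σ x ≠ 0 := fun h => hyx (σ.injective (hy.trans h.symm))
    have hy_top : p y = sortDesc p 0 := by rw [← hy, sortDesc_apply_of_antitone hσ]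
    rw [waterFill_of_ne hσx, sortDesc_apply_of_antitone hσ, min_eq_left hx, hy_top,
      min_eq_left (lt_sortDesc_zero hd hlt).le]
  · rw [waterFill_of_ne hy, sortDesc_apply_of_antitone hσ]

theorem marginalY_optimalFinal_of_lt (hsum : ∑ y, p y = 1) :
    marginalY (optimalFinal p σ (fillMass (sortDesc p) θ)) = p := by
  have hθ := lt_sortDesc_zero hd hlt
  have sum_X := sum_optimalX_of_lt hd hσ hlt hsum
  have optimalX_eq := optimalX_eq_max_div hd hσ hlt
  have diag (y : Fin n) : optimalFinal p σ (fillMass (sortDesc p) θ) y y =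
      optimalX p σ (fillMass (sortDesc p) θ) y * (1 - fillMass (sortDesc p) θ) := by
    rw [optimalFinal, optimalCond, if_pos rfl, fanoDist_fillMass hd, waterFill_zero]
  have off_diag {x y : Fin n} (hyx : y ≠ x) := optimalFinal_of_ne hd hσ hlt hyx
  set W := fillMass (sortDesc p) θ
  ext y
  have column (x : Fin n) : optimalFinal p σ W x y = optimalX p σ W x * min θ (p y) +
      if x = y then optimalX p σ W y * (1 - W - min θ (p y)) else 0 := by
    split_ifs with hxy
    · rw [hxy, diag]
      ring
    · rw [off_diag (Ne.symm hxy), add_zero]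
  have sum_column : marginalY (optimalFinal p σ W) y =
      min θ (p y) + optimalX p σ W y * (1 - W - min θ (p y)) := by
    simp only [marginalY, column, Finset.sum_add_distrib, ← Finset.sum_mul,
      sum_X, Finset.sum_ite_eq', Finset.mem_univ, if_true, one_mul]
  rw [sum_column]
  rcases lt_or_ge (p y) θ with hy | hy
  · rw [optimalX_eq_zero_of_lt hd hσ hlt hy, min_eq_right hy.le, zero_mul, add_zero]
  · rw [optimalX_eq, max_eq_left (sub_nonneg.2 hy), min_eq_left hy,
      div_mul_cancel₀ _ (by linarith), add_sub_cancel]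

end Level

theorem marginalY_optimalFinal_of_top (hd : IsDescending (sortDesc p))
    (hσ : Antitone fun k => p (σ.symm k)) :
    marginalY (optimalFinal p σ (1 - sortDesc p 0)) = p := by
  have fanoDist_top : fanoDist p (1 - sortDesc p 0) = sortDesc p := by
    rw [← hd.fillMass_top, fanoDist_fillMass hd, hd.waterFill_top]
  ext y
  simp only [marginalY, optimalFinal, optimalX_eq_ite (sub_sub_cancel _ _).le, ite_mul, one_mul,
    zero_mul, Finset.sum_ite_eq', Finset.mem_univ, if_true, optimalCond_eq_fanoDist_swap,
    Equiv.apply_symm_apply, Equiv.swap_self, Equiv.trans_refl, fanoDist_top,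
    sortDesc_apply_of_antitone hσ]

variable (hpos : ∀ y, 0 ≤ p y) (hsum : ∑ y, p y = 1) (hσ : Antitone fun k => p (σ.symm k))
  (hW : W ∈ Icc 0 (1 - sortDesc p 0))

include hpos hsum hσ hW

theorem optimalX_nonneg (x : Fin n) : 0 ≤ optimalX p σ W x := by
  have hd := isDescending_sortDesc hpos hsum
  rcases hW.2.lt_or_eq with hlt | rfl
  · obtain ⟨θ, -, rfl⟩ := hd.exists_fillMass_eq hW
    rw [optimalX_eq_max_div hd hσ hlt]
    have := lt_sortDesc_zero hd hlt
    exact div_nonneg (le_max_right _ _) (by linarith)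
  · rw [optimalX_eq_ite (sub_sub_cancel _ _).le]
    split_ifs
    exacts [zero_le_one, le_rfl]

theorem sum_optimalX : ∑ x, optimalX p σ W x = 1 := by
  have hd := isDescending_sortDesc hpos hsum
  rcases hW.2.lt_or_eq with hlt | rfl
  · obtain ⟨θ, -, rfl⟩ := hd.exists_fillMass_eq hW
    exact sum_optimalX_of_lt hd hσ hlt hsum
  · simp [optimalX_eq_ite (p := p) (sub_sub_cancel _ _).le]

theorem optimalFinal_nonneg (x y : Fin n) : 0 ≤ optimalFinal p σ W x y := by
  refine mul_nonneg (optimalX_nonneg hpos hsum hσ hW x) ?_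
  rw [optimalCond_eq_fanoDist_swap]
  exact fanoDist_nonneg (isDescending_sortDesc hpos hsum) hW _

theorem marginalY_optimalFinal : marginalY (optimalFinal p σ W) = p := by
  have hd := isDescending_sortDesc hpos hsum
  rcases hW.2.lt_or_eq with hlt | rfl
  · obtain ⟨θ, -, rfl⟩ := hd.exists_fillMass_eq hW
    exact marginalY_optimalFinal_of_lt hd hσ hlt hsum
  · exact marginalY_optimalFinal_of_top hd hσ

theorem sum_optimalFinal_diag : ∑ y, optimalFinal p σ W y y = 1 - W := by
  simp only [optimalFinal, optimalCond, if_true, ← Finset.sum_mul,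
    sum_optimalX hpos hsum hσ hW, one_mul,
    fanoDist_zero (isDescending_sortDesc hpos hsum) hW]

theorem condEntropy_optimalFinal :
    condEntropy (optimalFinal p σ W) = shannon (fanoDist p W) := by
  have row_sum (x : Fin n) : ∑ y, optimalCond p σ W x y = 1 :=
    (sum_optimalCond x).trans (sum_fanoDist (isDescending_sortDesc hpos hsum) hW)
  rw [condEntropy_eq_sum_mul_shannon (p := optimalFinal p σ W) (fun _ _ => rfl)
    fun x _ => row_sum x]
  simp only [shannon_optimalCond, ← Finset.sum_mul, sum_optimalX hpos hsum hσ hW, one_mul]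

end OptimalFinal

/-! ### Transport from the error-free distribution -/

section Transport

variable {n : ℕ} {N : Fin n → SimpleGraph (Fin n)} {pY : Fin n → ℝ} {p q : Fin n → Fin n → ℝ}
  {π : Fin n → Fin n → Fin n → ℝ}

/-- The probability that the plan `π` carries from `(u, y)` to a different state `(x, y)`. -/
def moved (π : Fin n → Fin n → Fin n → ℝ) (y x u : Fin n) : ℝ := if x = u then 0 else π y x u

/-- Total probability that changes its state under the plan `π`. -/
def movedMass (π : Fin n → Fin n → Fin n → ℝ) : ℝ := ∑ y, ∑ x, ∑ u, moved π y x u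

/-- The plan that carries probability from `(y, y)` directly to its destination; it is the only
plan starting from the error-free distribution. -/
def directPlan (q : Fin n → Fin n → ℝ) (y x u : Fin n) : ℝ := if u = y then q x y else 0

theorem moved_sub_moved (π : Fin n → Fin n → Fin n → ℝ) (y x u : Fin n) :
    moved π y x u - moved π y u x = π y x u - π y u x := by
  rcases eq_or_ne x u with rfl | hxu
  · rw [sub_self, sub_self]
  · rw [moved, moved, if_neg hxu, if_neg hxu.symm]

namespace IsTransportPlan

variable (hπ : IsTransportPlan p q π)

include hπ

theorem moved_nonneg (y x u : Fin n) : 0 ≤ moved π y x u := by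
  rw [moved]
  split_ifs
  exacts [le_rfl, hπ.nonneg y x u]

theorem le_source (y x u : Fin n) : π y x u ≤ p u y := by
  rw [← hπ.source]
  exact Finset.single_le_sum (fun v _ => hπ.nonneg y v u) (Finset.mem_univ x)

theorem le_target (y x u : Fin n) : π y x u ≤ q x y := by
  rw [← hπ.target]
  exact Finset.single_le_sum (fun v _ => hπ.nonneg y x v) (Finset.mem_univ u)

theorem transportCost_eq_ofReal_movedMass (hadj : ∀ y x u, 0 < moved π y x u → (N y).Adj u x) :
    transportCost N π = ENNReal.ofReal (movedMass π) := by
  have hcost (y x u : Fin n) :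
      ((N y).edist u x : ENNReal) * ENNReal.ofReal (π y x u) = ENNReal.ofReal (moved π y x u) := by
    rcases eq_or_ne x u with rfl | hxu
    · simp [moved]
    have hmoved : moved π y x u = π y x u := if_neg hxu
    rcases (hπ.nonneg y x u).eq_or_lt with h | h
    · simp [hmoved, ← h]
    · rw [SimpleGraph.edist_eq_one_iff_adj.2 (hadj y x u (by rwa [hmoved])), hmoved]
      simp
  have hu (y x : Fin n) := Finset.sum_nonneg fun u (_ : u ∈ Finset.univ) => hπ.moved_nonneg y x u
  have hx (y : Fin n) := Finset.sum_nonneg fun x (_ : x ∈ Finset.univ) => hu y x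
  rw [transportCost, movedMass, ENNReal.ofReal_sum_of_nonneg fun y _ => hx y]
  refine Finset.sum_congr rfl fun y _ => ?_
  rw [ENNReal.ofReal_sum_of_nonneg fun x _ => hu y x]
  refine Finset.sum_congr rfl fun x _ => ?_
  rw [ENNReal.ofReal_sum_of_nonneg fun u _ => hπ.moved_nonneg y x u]
  exact Finset.sum_congr rfl fun u _ => hcost y x u

end IsTransportPlan

theorem moved_directPlan (y x u : Fin n) :
    moved (directPlan q) y x u = if u = y then if x = y then 0 else q x y else 0 := by
  rw [moved, directPlan]
  grind

theorem movedMass_directPlan (q : Fin n → Fin n → ℝ) :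
    movedMass (directPlan q) = ∑ y, marginalY q y - ∑ y, q y y := by
  have hexcept (x y : Fin n) :
      (if x = y then 0 else q x y) = q x y - if x = y then q x y else 0 := by
    split_ifs <;> ring
  simp only [movedMass, moved_directPlan, Finset.sum_ite_eq', Finset.mem_univ, if_true, hexcept,
    Finset.sum_sub_distrib, marginalY]

theorem adj_of_moved_directPlan_pos (hadj : ∀ y x, x ≠ y → (N y).Adj y x) {y x u : Fin n}
    (h : 0 < moved (directPlan q) y x u) : (N y).Adj u x := by
  rw [moved_directPlan] at h
  split_ifs at h with huy hxy
  exacts [absurd h (lt_irrefl 0), huy ▸ hadj y x hxy, absurd h (lt_irrefl 0)]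

theorem directPlan_swap_eq_zero {y x u : Fin n} (hxu : x ≠ u) (h : 0 < directPlan q y x u) :
    directPlan q y u x = 0 := by
  rw [directPlan] at h
  split_ifs at h with huy
  exacts [if_neg fun hxy => hxu (hxy.trans huy.symm), absurd h (lt_irrefl 0)]

variable (hq : ∀ x y, 0 ≤ q x y) (hY : marginalY q = pY)

include hq hY

theorem isTransportPlan_directPlan : IsTransportPlan (initialDist pY) q (directPlan q) where
  nonneg y x u := by
    rw [directPlan]
    split_ifs
    exacts [hq x y, le_rfl]
  source y u := by
    simp only [directPlan, initialDist]
    split_ifs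
    exacts [congrFun hY y, Finset.sum_const_zero]
  target y x := by simp only [directPlan, Finset.sum_ite_eq', Finset.mem_univ, if_true]

omit hq hY in
theorem IsTransportPlan.eq_directPlan (hπ : IsTransportPlan (initialDist pY) q π) :
    π = directPlan q := by
  have hstart (y x u : Fin n) (huy : u ≠ y) : π y x u = 0 :=
    le_antisymm ((hπ.le_source y x u).trans_eq (if_neg huy)) (hπ.nonneg y x u)
  ext y x u
  rw [directPlan]
  split_ifs with huy
  · rw [← hπ.target y x, huy, Finset.sum_eq_single y (fun v _ hv => hstart y x v hv) (by simp)]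
  · exact hstart y x u huy

theorem wasserstein_initialDist :
    wasserstein N (initialDist pY) q = transportCost N (directPlan q) := by
  have hplans : {π | IsTransportPlan (initialDist pY) q π} = {directPlan q} := by
    ext π
    exact ⟨IsTransportPlan.eq_directPlan, fun h => h ▸ isTransportPlan_directPlan hq hY⟩
  rw [wasserstein, hplans, iInf_singleton]

theorem isOptimalPlan_directPlan : IsOptimalPlan N (initialDist pY) q (directPlan q) :=
  ⟨isTransportPlan_directPlan hq hY, (wasserstein_initialDist hq hY).symm⟩

theorem wasserstein_initialDist_eq_ofReal (hadj : ∀ y x, x ≠ y → (N y).Adj y x) :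
    wasserstein N (initialDist pY) q = ENNReal.ofReal (∑ y, pY y - ∑ y, q y y) := by
  rw [wasserstein_initialDist hq hY,
    (isTransportPlan_directPlan hq hY).transportCost_eq_ofReal_movedMass fun _ _ _ =>
      adj_of_moved_directPlan_pos hadj,
    movedMass_directPlan, hY]

end Transport

/-! ### Constant protocols -/

theorem sub_eq_tanh_half_log_div_mul_add {a b : ℝ} (ha : 0 < a) (hb : 0 < b) :
    a - b = Real.tanh (Real.log (a / b) / 2) * (a + b) := by
  set F := Real.log (a / b) with hF
  have ha_eq : a = Real.exp (F / 2) * Real.exp (F / 2) * b := by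
    rw [← Real.exp_add, add_halves, hF, Real.exp_log (div_pos ha hb), div_mul_cancel₀ _ hb.ne']
  rw [Real.tanh_eq, ha_eq, Real.exp_neg]
  field_simp

namespace IsConstantProtocol

variable {n : ℕ} {N : Fin n → SimpleGraph (Fin n)} {pY : Fin n → ℝ} {τ : ℝ}
  {P : FeedbackProcess N pY τ} {π : Fin n → Fin n → Fin n → ℝ} {q : Fin n → Fin n → ℝ} {J A : ℝ}

theorem meanActivity_eq (hP : IsConstantProtocol P π J A) (hτ : 0 < τ) : P.meanActivity = A := by
  rw [FeedbackProcess.meanActivity,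
    intervalIntegral.integral_congr_Ioo_of_le hτ.le hP.activity_const,
    intervalIntegral.integral_const, sub_zero, smul_eq_mul, mul_div_cancel_left₀ _ hτ.ne']

theorem exists_ae_current_eq (hπ : ∀ y x u, 0 ≤ π y x u) (hP : IsConstantProtocol P π J A)
    (hτ : 0 ≤ τ) : ∃ F, ∀ᵐ t ∂volume.restrict (Ioo 0 τ), ∀ y x u, x ≠ u → π y u x = 0 →
      P.current t y x u * P.force t y x u = F * P.current t y x u ∧
      P.current t y x u = Real.tanh (F / 2) * (P.jump t y x u + P.jump t y u x) := by
  obtain ⟨F, hF⟩ := hP.force_const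
  refine ⟨F, ?_⟩
  filter_upwards [P.ae_pos_of_current_ne_zero hτ, ae_restrict_mem measurableSet_Ioo]
    with t hpos ht y x u hxu hback
  have hjump := P.jump_nonneg ht y x u
  have hjump' := P.jump_nonneg ht y u x
  rcases (add_nonneg hjump hjump').eq_or_lt with hzero | hsum
  · have h : P.jump t y x u = 0 := by linarith
    have h' : P.jump t y u x = 0 := by linarith
    simp [FeedbackProcess.current, h, h']
  have hplan : 0 < π y x u := (hπ y x u).lt_of_ne' fun hzero => hsum.ne' <| by
    rw [hP.off_plan t ht y x u hxu hzero hback, hP.off_plan t ht y u x hxu.symm hback hzero,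
      add_zero]
  have hboth : 0 < P.jump t y x u ∧ 0 < P.jump t y u x := by
    by_cases hJ : P.current t y x u = 0
    · rw [FeedbackProcess.current] at hJ
      constructor <;> linarith
    · obtain ⟨hf, hb⟩ := hpos y x u hJ
      exact ⟨mul_pos hf.1 hf.2, mul_pos hb.1 hb.2⟩
  have hforce := hF t ht y x u hxu hplan hsum
  refine ⟨by rw [hforce, mul_comm], ?_⟩
  rw [← hforce]
  exact sub_eq_tanh_half_log_div_mul_add hboth.1 hboth.2

theorem exists_ae_outSign_mul_current_eq (hq : ∀ x y, 0 ≤ q x y)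
    (hP : IsConstantProtocol P (directPlan q) J A) (hτ : 0 ≤ τ) :
    ∃ F, ∀ᵐ t ∂volume.restrict (Ioo 0 τ), ∀ y x u,
      P.current t y x u * P.force t y x u =
        F * (FeedbackProcess.outSign y x u * P.current t y x u) ∧
      FeedbackProcess.outSign y x u * P.current t y x u =
        Real.tanh (F / 2) * (P.jump t y x u + P.jump t y u x) := by
  have hplan (y x u : Fin n) : 0 ≤ directPlan q y x u := by
    rw [directPlan]
    split_ifs
    exacts [hq x y, le_rfl]
  obtain ⟨F, hF⟩ := hP.exists_ae_current_eq hplan hτ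
  refine ⟨F, ?_⟩
  filter_upwards [hF, ae_restrict_mem measurableSet_Ioo] with t hcurrent ht y x u
  rcases eq_or_ne x u with rfl | hxu
  · simp [FeedbackProcess.outSign, FeedbackProcess.current, P.jump_self ht]
  by_cases hxy : x = y
  · have huy : u ≠ y := fun h => hxu (hxy.trans h.symm)
    have hin := hcurrent y u x hxu.symm (if_neg huy)
    rw [FeedbackProcess.outSign, if_pos hxy, if_neg huy, P.current_swap t y u x,
      P.force_swap t y u x, add_comm (P.jump t y x u)]
    constructor <;> linarith [hin.1, hin.2]
  · have hout := hcurrent y x u hxu (if_neg hxy)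
    by_cases huy : u = y
    · rwa [FeedbackProcess.outSign, if_pos huy, if_neg hxy, sub_zero, one_mul]
    · have hjump := hP.off_plan t ht y x u hxu (if_neg huy) (if_neg hxy)
      have hjump' := hP.off_plan t ht y u x hxu.symm (if_neg hxy) (if_neg huy)
      simp [FeedbackProcess.current, hjump, hjump']

theorem exists_ae_dissipation_eq (hq : ∀ x y, 0 ≤ q x y)
    (hP : IsConstantProtocol P (directPlan q) J A) (hτ : 0 ≤ τ) :
    ∃ F, ∀ᵐ t ∂volume.restrict (Ioo 0 τ),
      P.dissipation t = F * P.outflow t ∧ P.outflow t = Real.tanh (F / 2) * P.activity t := by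
  obtain ⟨F, hF⟩ := hP.exists_ae_outSign_mul_current_eq hq hτ
  refine ⟨F, ?_⟩
  filter_upwards [hF, ae_restrict_mem measurableSet_Ioo] with t h ht
  constructor
  · simp only [FeedbackProcess.dissipation, P.outflow_eq_half_sum, fun y x u => (h y x u).1,
      ← Finset.mul_sum]
    ring
  · simp only [P.activity_eq_half_sum ht, P.outflow_eq_half_sum, fun y x u => (h y x u).2,
      ← Finset.mul_sum]
    ring

theorem totalProduction_eq (hq : ∀ x y, 0 ≤ q x y)
    (hP : IsConstantProtocol P (directPlan q) J A) (hτ : 0 < τ) {W : ℝ}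
    (hW : ∑ y, pY y - ∑ y, P.prob τ y y = W) :
    P.totalProduction = 2 * W * Real.artanh (W / (τ * P.meanActivity)) := by
  obtain ⟨F, hF⟩ := hP.exists_ae_dissipation_eq hq hτ.le
  have hproduction : P.totalProduction = F * W := by
    rw [← hW, ← P.integral_outflow hτ.le, ← P.integral_dissipation hτ.le, ← integral_const_mul]
    exact integral_congr_ae (hF.mono fun t h => h.1)
  have hout : W = Real.tanh (F / 2) * (τ * P.meanActivity) := by
    rw [← hW, ← P.integral_outflow hτ.le, ← P.integral_activity hτ, ← integral_const_mul]
    exact integral_congr_ae (hF.mono fun t h => h.2)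
  rw [hproduction]
  rcases eq_or_ne (τ * P.meanActivity) 0 with h0 | h0
  · rw [hout, h0, mul_zero, mul_zero, mul_zero, zero_mul]
  · rw [(div_eq_iff h0).2 hout, Real.artanh_tanh]
    ring

end IsConstantProtocol

section PlanProcess

variable {n : ℕ} {N : Fin n → SimpleGraph (Fin n)} {pY : Fin n → ℝ} {p q : Fin n → Fin n → ℝ}
  {π : Fin n → Fin n → Fin n → ℝ} {τ k : ℝ}

/-- Jump frequencies, constant in time, that carry out the plan `π` within the time `τ`. Each
probability `m` moved by the plan contributes `k m` to the backward frequency, and the excess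
`m / τ` of the forward frequency transports it. -/
def planJump (π : Fin n → Fin n → Fin n → ℝ) (τ k : ℝ) (y x u : Fin n) : ℝ :=
  (k + 1 / τ) * moved π y x u + k * moved π y u x

/-- Linear interpolation in time from `p` to `q`. -/
def interpolation (p q : Fin n → Fin n → ℝ) (τ t : ℝ) (x y : Fin n) : ℝ :=
  (1 - t / τ) * p x y + t / τ * q x y

theorem planJump_sub_planJump (y x u : Fin n) :
    planJump π τ k y x u - planJump π τ k y u x = (π y x u - π y u x) / τ := by
  rw [← moved_sub_moved π, planJump, planJump]
  ring

theorem sum_planJump (π : Fin n → Fin n → Fin n → ℝ) (τ k : ℝ) :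
    ∑ y, ∑ x, ∑ u, planJump π τ k y x u = movedMass π * (2 * k + 1 / τ) := by
  have hswap (y : Fin n) : ∑ x, ∑ u, moved π y u x = ∑ x, ∑ u, moved π y x u := Finset.sum_comm
  simp only [planJump, Finset.sum_add_distrib, ← Finset.mul_sum, hswap, movedMass]
  ring

theorem intervalIntegrable_log_interpolation (p q : Fin n → Fin n → ℝ) (τ : ℝ) (x y : Fin n) :
    IntervalIntegrable (fun t => Real.log (interpolation p q τ t x y)) volume 0 τ := by
  refine MeromorphicOn.intervalIntegrable_log (f := fun t => interpolation p q τ t x y)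
    fun t _ => ?_
  have hanalytic : AnalyticAt ℝ (fun t => interpolation p q τ t x y) t := by
    simp only [interpolation, div_eq_mul_inv]
    fun_prop
  exact hanalytic.meromorphicAt

namespace IsTransportPlan

variable (hπ : IsTransportPlan p q π)

include hπ

theorem source_nonneg (x y : Fin n) : 0 ≤ p x y :=
  (hπ.nonneg y x x).trans (hπ.le_source y x x)

theorem target_nonneg (x y : Fin n) : 0 ≤ q x y :=
  (hπ.nonneg y x x).trans (hπ.le_target y x x)

theorem sum_planJump_sub_planJump (τ k : ℝ) (x y : Fin n) :
    ∑ u, (planJump π τ k y x u - planJump π τ k y u x) = (q x y - p x y) / τ := by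
  simp only [planJump_sub_planJump, ← Finset.sum_div, Finset.sum_sub_distrib, hπ.target, hπ.source]

theorem interpolation_nonneg {t : ℝ} (ht : t ∈ Icc 0 τ) (x y : Fin n) :
    0 ≤ interpolation p q τ t x y := by
  have hτ := ht.1.trans ht.2
  have hle : t / τ ≤ 1 := div_le_one_of_le₀ ht.2 hτ
  exact add_nonneg (mul_nonneg (sub_nonneg.2 hle) (hπ.source_nonneg x y))
    (mul_nonneg (div_nonneg ht.1 hτ) (hπ.target_nonneg x y))

variable (hk : 0 < k) (hτ : 0 < τ)

include hk hτ

theorem planJump_nonneg (y x u : Fin n) : 0 ≤ planJump π τ k y x u :=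
  add_nonneg (mul_nonneg (by positivity) (hπ.moved_nonneg y x u))
    (mul_nonneg hk.le (hπ.moved_nonneg y u x))

theorem planJump_pos_iff (y x u : Fin n) :
    0 < planJump π τ k y x u ↔ 0 < moved π y x u ∨ 0 < moved π y u x := by
  have hforward := hπ.moved_nonneg y x u
  have hbackward := hπ.moved_nonneg y u x
  refine ⟨fun h => ?_, ?_⟩
  · by_contra! hle
    rw [planJump, le_antisymm hle.1 hforward, le_antisymm hle.2 hbackward] at h
    simp at h
  · rintro (h | h) <;> rw [planJump] <;> positivity

theorem planJump_pos_comm (y x u : Fin n) :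
    0 < planJump π τ k y x u ↔ 0 < planJump π τ k y u x := by
  rw [hπ.planJump_pos_iff hk hτ, hπ.planJump_pos_iff hk hτ, or_comm]

theorem interpolation_pos {t : ℝ} (ht : t ∈ Ioo 0 τ) {y x u : Fin n}
    (h : 0 < planJump π τ k y x u) : 0 < interpolation p q τ t u y := by
  have hstart : 0 < 1 - t / τ := sub_pos.2 ((div_lt_one hτ).2 ht.2)
  have hend : 0 < t / τ := div_pos ht.1 hτ
  have hp := hπ.source_nonneg u y
  have hq := hπ.target_nonneg u y
  have moved_le (v w : Fin n) : moved π y v w ≤ π y v w := by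
    rw [moved]
    split_ifs
    exacts [hπ.nonneg y v w, le_rfl]
  rw [interpolation]
  rcases (hπ.planJump_pos_iff hk hτ y x u).1 h with hm | hm
  · have hp_pos := hm.trans_le ((moved_le x u).trans (hπ.le_source y x u))
    positivity
  · have hq_pos := hm.trans_le ((moved_le u x).trans (hπ.le_target y u x))
    positivity

theorem planJump_div_mul_interpolation {t : ℝ} (ht : t ∈ Ioo 0 τ) (y x u : Fin n) :
    planJump π τ k y x u / interpolation p q τ t u y * interpolation p q τ t u y =
      planJump π τ k y x u := by
  rcases (hπ.planJump_nonneg hk hτ y x u).eq_or_lt with h | h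
  · rw [← h, zero_div, zero_mul]
  · exact div_mul_cancel₀ _ (hπ.interpolation_pos hk hτ ht h).ne'

theorem intervalIntegrable_log_rate_div_mul_planJump (y x u : Fin n) :
    IntervalIntegrable (fun t => Real.log (planJump π τ k y x u / interpolation p q τ t u y /
      (planJump π τ k y u x / interpolation p q τ t x y)) * planJump π τ k y x u) volume 0 τ := by
  rcases (hπ.planJump_nonneg hk hτ y x u).eq_or_lt with h | h
  · simp [← h]
  have h' := (hπ.planJump_pos_comm hk hτ y x u).1 h
  refine IntervalIntegrable.mul_const (IntervalIntegrable.congr_uIoo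
    ((intervalIntegrable_const (c := Real.log (planJump π τ k y x u / planJump π τ k y u x))).add
      ((intervalIntegrable_log_interpolation p q τ x y).sub
        (intervalIntegrable_log_interpolation p q τ u y))) fun t ht => ?_) _
  rw [uIoo_of_le hτ.le] at ht
  have hu := hπ.interpolation_pos hk hτ ht h
  have hx := hπ.interpolation_pos hk hτ ht h'
  rw [← Real.log_div hx.ne' hu.ne', ← Real.log_mul (by positivity) (by positivity),
    div_div_div_eq, div_mul_div_comm, mul_comm (interpolation p q τ t u y)]

end IsTransportPlan

/-- The process that carries out the plan `π` at constant jump frequencies. -/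
def planProcess (hπ : IsTransportPlan (initialDist pY) q π)
    (hadj : ∀ y x u, 0 < moved π y x u → (N y).Adj u x) (hk : 0 < k) (hτ : 0 < τ) :
    FeedbackProcess N pY τ where
  rate t y x u := planJump π τ k y x u / interpolation (initialDist pY) q τ t u y
  prob := interpolation (initialDist pY) q τ
  rate_nonneg t ht y x u := div_nonneg (hπ.planJump_nonneg hk hτ y x u)
    (hπ.interpolation_nonneg (Ioo_subset_Icc_self ht) u y)
  rate_eq_zero t _ y x u hux := by
    rw [div_eq_zero_iff]
    refine .inl (le_antisymm (not_lt.1 fun h => hux ?_) (hπ.planJump_nonneg hk hτ y x u))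
    exact ((hπ.planJump_pos_iff hk hτ y x u).1 h).elim (hadj y x u) fun h => (hadj y u x h).symm
  rate_pos_symm t ht y x u h := by
    have hjump := (hπ.planJump_nonneg hk hτ y x u).lt_of_ne' (left_ne_zero_of_mul h.ne')
    have hjump' := (hπ.planJump_pos_comm hk hτ y x u).1 hjump
    exact div_pos hjump' (hπ.interpolation_pos hk hτ ht hjump')
  prob_nonneg t ht := hπ.interpolation_nonneg ht
  prob_zero := by
    ext x y
    simp [interpolation]
  jump_integrable y x u :=
    (intervalIntegrable_const (c := planJump π τ k y x u)).congr_uIoo fun t ht =>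
      (hπ.planJump_div_mul_interpolation hk hτ (uIoo_of_le hτ.le ▸ ht) y x u).symm
  master t ht x y := by
    rw [intervalIntegral.integral_congr_Ioo_of_le
        (g := fun _ => (q x y - initialDist pY x y) / τ) ht.1 fun s hs => ?_,
      intervalIntegral.integral_const, interpolation, interpolation, smul_eq_mul]
    · ring
    have hs_mem : s ∈ Ioo 0 τ := ⟨hs.1, hs.2.trans_le ht.2⟩
    simp only [hπ.planJump_div_mul_interpolation hk hτ hs_mem, hπ.sum_planJump_sub_planJump]
  heat_integrable y x u :=
    (hπ.intervalIntegrable_log_rate_div_mul_planJump hk hτ y x u).congr_uIoo fun t ht => by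
      simp only [hπ.planJump_div_mul_interpolation hk hτ (uIoo_of_le hτ.le ▸ ht)]

section

variable (hπ : IsTransportPlan (initialDist pY) q π)
  (hadj : ∀ y x u, 0 < moved π y x u → (N y).Adj u x) (hk : 0 < k) (hτ : 0 < τ)

theorem planProcess_prob_final : (planProcess hπ hadj hk hτ).prob τ = q := by
  ext x y
  simp [planProcess, interpolation, hτ.ne']

theorem planProcess_jump {t : ℝ} (ht : t ∈ Ioo 0 τ) (y x u : Fin n) :
    (planProcess hπ hadj hk hτ).jump t y x u = planJump π τ k y x u :=
  hπ.planJump_div_mul_interpolation hk hτ ht y x u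

theorem planProcess_current {t : ℝ} (ht : t ∈ Ioo 0 τ) (y x u : Fin n) :
    (planProcess hπ hadj hk hτ).current t y x u = (π y x u - π y u x) / τ := by
  rw [FeedbackProcess.current, planProcess_jump hπ hadj hk hτ ht,
    planProcess_jump hπ hadj hk hτ ht, planJump_sub_planJump]

theorem isConstantProtocol_planProcess
    (hdirected : ∀ y x u, x ≠ u → 0 < π y x u → π y u x = 0) :
    IsConstantProtocol (planProcess hπ hadj hk hτ) π (movedMass π / τ)
      (movedMass π * (2 * k + 1 / τ)) where
  transport y x u _ := by
    rw [intervalIntegral.integral_congr_Ioo_of_le hτ.le fun t ht =>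
      planProcess_current hπ hadj hk hτ ht y x u, intervalIntegral.integral_const, sub_zero,
      smul_eq_mul, mul_div_cancel₀ _ hτ.ne']
  off_plan t ht y x u hxu h h' := by
    rw [planProcess_jump hπ hadj hk hτ ht, planJump, moved, moved, if_neg hxu, if_neg hxu.symm,
      h, h', mul_zero, mul_zero, add_zero]
  current_const t ht := by
    simp only [planProcess_current hπ hadj hk hτ ht, movedMass, Finset.sum_div]
    refine Finset.sum_congr rfl fun y _ => Finset.sum_congr rfl fun x _ =>
      Finset.sum_congr rfl fun u _ => ?_
    rw [moved]
    rcases eq_or_ne x u with hxu | hxu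
    · rw [if_neg fun h => h.1 hxu, if_pos hxu, zero_div]
    rcases (hπ.nonneg y x u).eq_or_lt with h | h
    · rw [if_neg fun hpos => hpos.2.ne h, if_neg hxu, ← h, zero_div]
    · rw [if_pos ⟨hxu, h⟩, if_neg hxu, hdirected y x u hxu h, sub_zero]
  activity_const t ht := by
    simp only [FeedbackProcess.activity_eq _ ht, planProcess_jump hπ hadj hk hτ ht, sum_planJump]
  force_const := by
    refine ⟨Real.log ((k + 1 / τ) / k), fun t ht y x u hxu h _ => ?_⟩
    rw [FeedbackProcess.force, planProcess_jump hπ hadj hk hτ ht,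
      planProcess_jump hπ hadj hk hτ ht, planJump, planJump, moved, moved, if_neg hxu,
      if_neg hxu.symm, hdirected y x u hxu h, mul_zero, mul_zero, add_zero, zero_add,
      mul_div_mul_right _ _ h.ne']

end

theorem exists_mul_two_mul_add_eq {W A : ℝ} (hτ : 0 < τ)
    (hA : (0 < W ∧ W < τ * A) ∨ (W = 0 ∧ A = 0)) : ∃ k > 0, W * (2 * k + 1 / τ) = A := by
  rcases hA with ⟨hW, hWA⟩ | ⟨rfl, rfl⟩
  · have hlt : 1 / τ < A / W := by
      rw [div_lt_div_iff₀ hτ hW]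
      linarith
    refine ⟨(A / W - 1 / τ) / 2, by linarith, ?_⟩
    field_simp
    ring
  · exact ⟨1, one_pos, zero_mul _⟩

theorem exists_isConstantProtocol {A : ℝ} (hπ : IsTransportPlan (initialDist pY) q π)
    (hadj : ∀ y x u, 0 < moved π y x u → (N y).Adj u x)
    (hdirected : ∀ y x u, x ≠ u → 0 < π y x u → π y u x = 0) (hτ : 0 < τ)
    (hA : (0 < movedMass π ∧ movedMass π < τ * A) ∨ (movedMass π = 0 ∧ A = 0)) :
    ∃ P : FeedbackProcess N pY τ,
      P.prob τ = q ∧ IsConstantProtocol P π (movedMass π / τ) A := by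
  obtain ⟨k, hk, hkA⟩ := exists_mul_two_mul_add_eq hτ hA
  exact ⟨planProcess hπ hadj hk hτ, planProcess_prob_final hπ hadj hk hτ,
    hkA ▸ isConstantProtocol_planProcess hπ hadj hk hτ hdirected⟩

end PlanProcess

section AttainsFano

variable {n : ℕ} [NeZero n] {N : Fin n → SimpleGraph (Fin n)} {pY : Fin n → ℝ}
  {q : Fin n → Fin n → ℝ} {τ : ℝ}

/-- Joint distributions `q` with `Y`-marginal `pY` whose conditional entropy and probability of
error `∑ y, pY y - ∑ y, q y y` give equality in Fano's inequality
`minWasserstein_condEntropy_le`. -/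
structure AttainsFano (pY : Fin n → ℝ) (q : Fin n → Fin n → ℝ) : Prop where
  nonneg : ∀ x y, 0 ≤ q x y
  marginalY_eq : marginalY q = pY
  error_eq : ∑ y, pY y - ∑ y, q y y = minWasserstein pY (condEntropy q)

theorem attainsFano_optimalFinal (hpos : ∀ y, 0 ≤ pY y) (hsum : ∑ y, pY y = 1)
    {σ : Equiv.Perm (Fin n)} (hσ : Antitone fun k => pY (σ.symm k)) {I : ℝ}
    (hI : I ∈ Icc 0 (shannon pY)) :
    AttainsFano pY (optimalFinal pY σ (minWasserstein pY I)) ∧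
      condEntropy (optimalFinal pY σ (minWasserstein pY I)) = I := by
  have hd := isDescending_sortDesc hpos hsum
  have hW := minWasserstein_mem hd hI
  have hentropy := (condEntropy_optimalFinal hpos hsum hσ hW).trans
    (shannon_fanoDist_minWasserstein hd hI)
  refine ⟨⟨optimalFinal_nonneg hpos hsum hσ hW, marginalY_optimalFinal hpos hsum hσ hW, ?_⟩,
    hentropy⟩
  rw [hentropy, hsum, sum_optimalFinal_diag hpos hsum hσ hW, sub_sub_cancel]

namespace AttainsFano

variable (hq : AttainsFano pY q)

include hq

theorem abs_mutualInfo_sub : |mutualInfo q - mutualInfo (initialDist pY)| = condEntropy q := by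
  rw [mutualInfo_sub_mutualInfo_initialDist hq.marginalY_eq, abs_neg,
    abs_of_nonneg (condEntropy_nonneg hq.nonneg)]

theorem wasserstein_eq (hadj : ∀ y x, x ≠ y → (N y).Adj y x) {I : ℝ} (hI : condEntropy q = I) :
    wasserstein N (initialDist pY) q = ENNReal.ofReal (minWasserstein pY I) := by
  rw [wasserstein_initialDist_eq_ofReal hq.nonneg hq.marginalY_eq hadj, hq.error_eq, hI]

theorem entropyProduction_eq {P : FeedbackProcess N pY τ} {π : Fin n → Fin n → Fin n → ℝ}
    {J A β : ℝ} (hPq : P.prob τ = q) (hπ : IsTransportPlan (initialDist pY) q π)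
    (hP : IsConstantProtocol P π J A) (hτ : 0 < τ) (hβ : β ≠ 0) :
    P.entropyProduction β = activityBound pY τ P.meanActivity |P.infoChange| := by
  obtain rfl := hπ.eq_directPlan
  subst hPq
  rw [P.entropyProduction_eq_sub_abs hτ.le hβ, P.abs_infoChange hτ.le, activityBound,
    hP.totalProduction_eq hq.nonneg hτ hq.error_eq]
  ring

theorem exists_isConstantProtocol (hadj : ∀ y x, x ≠ y → (N y).Adj y x) (hτ : 0 < τ) {I A : ℝ}
    (hI : condEntropy q = I)
    (hA : (0 < minWasserstein pY I ∧ minWasserstein pY I < τ * A) ∨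
      (minWasserstein pY I = 0 ∧ A = 0)) :
    ∃ P : FeedbackProcess N pY τ,
      P.prob τ = q ∧ IsConstantProtocol P (directPlan q) (minWasserstein pY I / τ) A := by
  have hmass : movedMass (directPlan q) = minWasserstein pY I := by
    rw [movedMass_directPlan, hq.marginalY_eq, hq.error_eq, hI]
  rw [← hmass] at hA ⊢
  exact Feedback.exists_isConstantProtocol
    (isTransportPlan_directPlan hq.nonneg hq.marginalY_eq)
    (fun _ _ _ => adj_of_moved_directPlan_pos hadj)
    (fun _ _ _ => directPlan_swap_eq_zero) hτ hA

end AttainsFano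

end AttainsFano

end

end Feedback

open Set Feedback in
theorem mainTheorem3 {n : ℕ} [NeZero n] (N : Fin n → SimpleGraph (Fin n)) (pY : Fin n → ℝ)
    (hpos : ∀ y, 0 ≤ pY y) (hsum : ∑ y, pY y = 1) (β : ℝ) (hβ : 0 < β) (τ : ℝ) (hτ : 0 < τ) :
    -- `minWasserstein pY` is a genuine inverse function
    BijOn (fun W => shannon (fanoDist pY W)) (Icc 0 (1 - sortDesc pY 0)) (Icc 0 (shannon pY)) ∧
    -- the speed limit
    (∀ P : FeedbackProcess N pY τ,
      |P.infoChange| ≤ shannon pY ∧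
      minWasserstein pY |P.infoChange| / (τ * P.meanActivity) ∈ Ico 0 1 ∧
      activityBound pY τ P.meanActivity |P.infoChange| ≤ P.entropyProduction β) ∧
    -- attainment, under the condition that all direct transitions out of `x = y` are allowed
    ((∀ y x, x ≠ y → (N y).Adj y x) →
      ∀ σ : Equiv.Perm (Fin n), Antitone (fun k => pY (σ.symm k)) →
      ∀ I ∈ Icc 0 (shannon pY), ∀ W : ℝ, W = minWasserstein pY I →
        -- the optimal final distribution is admissible, at distance `W` and consumes `I`
        (∀ x y, 0 ≤ optimalFinal pY σ W x y) ∧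
        marginalY (optimalFinal pY σ W) = pY ∧
        wasserstein N (initialDist pY) (optimalFinal pY σ W) = ENNReal.ofReal W ∧
        |mutualInfo (optimalFinal pY σ W) - mutualInfo (initialDist pY)| = I ∧
        -- every constant protocol along an optimal plan attains equality
        (∀ (P : FeedbackProcess N pY τ) (π : Fin n → Fin n → Fin n → ℝ) (J A : ℝ),
          P.prob τ = optimalFinal pY σ W →
          IsOptimalPlan N (initialDist pY) (optimalFinal pY σ W) π →
          IsConstantProtocol P π J A →
          P.entropyProduction β = activityBound pY τ P.meanActivity |P.infoChange|) ∧
        -- such a protocol exists for every admissible value of the activity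
        (∀ A : ℝ, (0 < I ∧ W < τ * A) ∨ (I = 0 ∧ A = 0) →
          ∃ (P : FeedbackProcess N pY τ) (π : Fin n → Fin n → Fin n → ℝ),
            P.prob τ = optimalFinal pY σ W ∧
            IsOptimalPlan N (initialDist pY) (optimalFinal pY σ W) π ∧
            IsConstantProtocol P π (W / τ) A ∧
            P.meanActivity = A ∧ |P.infoChange| = I ∧
            P.entropyProduction β = activityBound pY τ A I)) := by
  have hd := isDescending_sortDesc hpos hsum
  refine ⟨bijOn_shannon_fanoDist hd, fun P => ⟨(P.abs_infoChange_mem hτ.le hsum).2,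
    P.speed_limit hpos hsum hτ hβ.ne'⟩, ?_⟩
  rintro hadj σ hσ I hI _ rfl
  obtain ⟨hq, hentropy⟩ := attainsFano_optimalFinal hpos hsum hσ hI
  have attained {P : FeedbackProcess N pY τ} {π J A} (hPq : P.prob τ = _)
      (hπ : IsTransportPlan _ _ π) (hP : IsConstantProtocol P π J A) :=
    hq.entropyProduction_eq hPq hπ hP hτ hβ.ne'
  refine ⟨hq.nonneg, hq.marginalY_eq, hq.wasserstein_eq hadj hentropy,
    hq.abs_mutualInfo_sub.trans hentropy,
    fun P π J A hPq hπ hP => attained hPq hπ.isPlan hP, fun A hA => ?_⟩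
  have hW_pos : 0 < I → 0 < minWasserstein pY I := fun hI_pos =>
    (minWasserstein_mem hd hI).1.lt_of_ne' fun h =>
      hI_pos.ne' ((minWasserstein_eq_zero_iff hd hI).1 h)
  obtain ⟨P, hPq, hP⟩ := hq.exists_isConstantProtocol hadj hτ hentropy
    (hA.imp (And.imp_left hW_pos) (And.imp_left (minWasserstein_eq_zero_iff hd hI).2))
  have hπ := isOptimalPlan_directPlan (N := N) hq.nonneg hq.marginalY_eq
  have hinfo : |P.infoChange| = I := by rw [P.abs_infoChange hτ.le, hPq, hentropy]
  have hactivity := hP.meanActivity_eq hτ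
  exact ⟨P, _, hPq, hπ, hP, hactivity, hinfo, hactivity ▸ hinfo ▸ attained hPq hπ.isPlan hP⟩
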